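/- Let $M$ be a compact connected smooth manifold (Hausdorff, without boundary) such that $H_1(M;\mathbb Z)$ is free with basis $\Gamma_1,\dots,\Gamma_b$. Let $\pi:\tilde M\to M$ be the universal Abelian cover, that is, a path-connected covering with $\pi_*(\pi_1(\tilde M,\tilde x))=[\pi_1(M,\pi\tilde x),\pi_1(M,\pi\tilde x)]$ for all $\tilde x\in\tilde M$. For $\vec n\in\mathbb Z^b$ let $\delta_{\vec n}$ be the deck transformation that moves each $\tilde x$ to the end point of any path starting at $\tilde x$ whose projection is a closed loop of homology class $\sum_j n_j\Gamma_j$. Let $\omega_1,\dots,\omega_b$ be smooth closed one-forms on $M$ (for example, harmonic one-forms of a Riemannian metric) with $\int_{\Gamma_j}\omega_i=\delta_{ij}$, fix $\tilde x_0\in\tilde M$, and define $\tilde\iota:\tilde M\to\mathbb R^b$ by $\tilde\iota_i(\tilde x)=\int_\gamma\pi^*\omega_i$, where $\gamma$ is any smooth path from $\tilde x_0$ to $\tilde x$. Let $f:M\to M$ be continuous, let $\tilde f:\tilde M\to\tilde M$ be a continuous lift of $f$, and let $A\in M_b(\mathbb Z)$ be the matrix of $f_*$ on $H_1(M;\mathbb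 Z)$ in the basis $\Gamma_1,\dots,\Gamma_b$. Assume that $f$ is $H_1$-expanding: every complex eigenvalue $\mu$ of $A$ satisfies $|\mu|>1$. Then $A^k$ is invertible over $\mathbb R$ for every $k\ge 0$, $A^k-I$ is invertible over $\mathbb R$ for every $k\ge1$, and the following hold. 1. The limit $\tilde\beta(\tilde x)=\lim_{k\to\infty}A^{-k}\,\tilde\iota(\tilde f^k(\tilde x))$ exists for every $\tilde x\in\tilde M$, and $\tilde\beta$ descends to a continuous map $\beta:M\to\mathbb T^b=\mathbb R^b/\mathbb Z^b$ with $\beta\circ f=\Phi_A\circ\beta$, where $\Phi_A$ is the toral endomorphism induced by $A$. 2. Let $\tilde M_0\subset\tilde M$ be a connected, relatively compact fundamental domain, so that $\tilde M=\bigsqcup_{\vec n\in\mathbb Z^b}\tilde M_{\vec n}$ with $\tilde M_{\vec n}=\delta_{\vec n}\tilde M_0$; write $\lfloor\tilde x\rfloor=\vec n$ if $\tilde x\in\tilde M_{\vec n}$, and let $d_k(\tilde x)=\lfloor\tilde f^k(\tilde x)\rfloor-\lfloor\tilde x\rfloor\in\mathbb Z^b$. Then for every $\tilde x\in\tilde M$,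 $$\lim_{k\to\infty}(A^k-I)^{-1}d_k(\tilde x)=\tilde\beta(\tilde x).$$ 3. The maps $\tilde\beta$ and $\beta$ do not depend on the choice of the one-forms $\omega_i$ with $\int_{\Gamma_j}\omega_i=\delta_{ij}$, nor on the base point $\tilde x_0$, used to define $\tilde\iota$. -/

import Mathlib

open Filter Topology Set
open scoped Manifold ContDiff unitInterval Simplicial

noncomputable section

namespace AbelianCover

universe u v

/-! ### First integral singular homology -/

section Homology

open CategoryTheory AlgebraicTopology

/-- The coefficient group `ℤ`, placed in the universe of the spaces considered. -/
abbrev coeffZ : ModuleCat.{u} ℤ := ModuleCat.of ℤ (ULift.{u} ℤ)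

/-- The first singular homology group `H₁(X; ℤ)`. -/
abbrev H1 (X : Type u) [TopologicalSpace X] : ModuleCat.{u} ℤ :=
  ((singularHomologyFunctor (ModuleCat.{u} ℤ) 1).obj coeffZ.{u}).obj (TopCat.of X)

/-- The map `f_* : H₁(X; ℤ) → H₁(Y; ℤ)` induced by a continuous map `f`. -/
def H1map {X Y : Type u} [TopologicalSpace X] [TopologicalSpace Y] (f : C(X, Y)) :
    H1 X →ₗ[ℤ] H1 Y :=
  (((singularHomologyFunctor (ModuleCat.{u} ℤ) 1).obj coeffZ.{u}).map (TopCat.ofHom f)).hom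

/-- A continuous curve `γ : [0,1] → X`, seen as a singular `1`-simplex of `X` going from
`γ 0` to `γ 1`. -/
def curveSimplex {X : Type u} [TopologicalSpace X] (γ : C(I, X)) :
    (TopCat.toSSet.obj (TopCat.of X)) _⦋1⦌ :=
  ((TopCat.of X).toSSetObjEquiv _).symm
    (γ.comp ⟨stdSimplexHomeomorphUnitInterval, stdSimplexHomeomorphUnitInterval.continuous⟩)

theorem curveSimplex_d {X : Type u} [TopologicalSpace X] (γ : C(I, X)) (h : γ 0 = γ 1) :
    (TopCat.toSSet.obj (TopCat.of X)).ιChainComplex (R := coeffZ.{u}) (curveSimplex γ) ≫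
      ((TopCat.toSSet.obj (TopCat.of X)).chainComplex coeffZ.{u}).d 1 0 = 0 := by
  have key : (TopCat.toSSet.obj (TopCat.of X)).δ 0 (curveSimplex γ) =
      (TopCat.toSSet.obj (TopCat.of X)).δ 1 (curveSimplex γ) := by
    refine TopCat.toSSetObj₀Equiv.injective ?_
    have hv (i j : Fin 2) (hij : i.succAbove 0 = j) :
        stdSimplex.map (S := ℝ) i.succAbove (default : stdSimplex ℝ (Fin 1)) =
          stdSimplex.vertex j := by
      rw [Subsingleton.elim (default : stdSimplex ℝ (Fin 1)) (stdSimplex.vertex 0),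
        stdSimplex.map_vertex, hij]
    have h0 : TopCat.toSSetObj₀Equiv ((TopCat.toSSet.obj (TopCat.of X)).δ 0 (curveSimplex γ)) =
        γ 1 := by
      rw [← stdSimplexHomeomorphUnitInterval_one]
      exact congrArg (fun z => γ (stdSimplexHomeomorphUnitInterval z)) (hv 0 1 rfl)
    have h1 : TopCat.toSSetObj₀Equiv ((TopCat.toSSet.obj (TopCat.of X)).δ 1 (curveSimplex γ)) =
        γ 0 := by
      rw [← stdSimplexHomeomorphUnitInterval_zero]
      exact congrArg (fun z => γ (stdSimplexHomeomorphUnitInterval z)) (hv 1 0 rfl)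
    rw [h0, h1, h]
  rw [SSet.ιChainComplex_d]
  simp [Fin.sum_univ_two, key]

/-- The homology class in `H₁(X; ℤ)` of a closed curve `γ`. -/
def loopClass {X : Type u} [TopologicalSpace X] (γ : C(I, X)) (h : γ 0 = γ 1) : H1 X :=
  (((TopCat.toSSet.obj (TopCat.of X)).chainComplex coeffZ.{u}).liftCycles
      ((TopCat.toSSet.obj (TopCat.of X)).ιChainComplex (curveSimplex γ)) 0 (by simp)
      (curveSimplex_d γ h) ≫
    ((TopCat.toSSet.obj (TopCat.of X)).chainComplex coeffZ.{u}).homologyπ 1).hom (ULift.up 1)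

/-- The integer matrix of `f_*` on `H₁(X; ℤ)` in the basis `Γ`. -/
def homologyMatrix {X : Type u} [TopologicalSpace X] {b : ℕ} (Γ : Module.Basis (Fin b) ℤ (H1 X))
    (f : C(X, X)) : Matrix (Fin b) (Fin b) ℤ :=
  LinearMap.toMatrix Γ Γ (H1map f)

end Homology

/-! ### Closed one-forms and their integrals along smooth paths -/

section Forms

variable {n : ℕ} {M : Type u} [TopologicalSpace M] [ChartedSpace (EuclideanSpace ℝ (Fin n)) M]

/-- The expression in the chart around `x₀` of a field of covectors `η` on `M`. -/
def chartRep (η : (x : M) → TangentSpace (𝓡 n) x →L[ℝ] ℝ) (x₀ : M)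
    (y : EuclideanSpace ℝ (Fin n)) : EuclideanSpace ℝ (Fin n) →L[ℝ] ℝ :=
  (η ((extChartAt (𝓡 n) x₀).symm y)).comp
    (mfderiv 𝓘(ℝ, EuclideanSpace ℝ (Fin n)) (𝓡 n) (extChartAt (𝓡 n) x₀).symm y)

variable (n M) in
/-- A smooth closed one-form on `M`: in every chart its coefficients are `C^∞` and its exterior
derivative vanishes (that is, the derivative of the coefficients is symmetric). -/
structure ClosedOneForm where
  /-- the covector at each point -/
  toFun : (x : M) → TangentSpace (𝓡 n) x →L[ℝ] ℝ
  smooth : ∀ x₀ : M, ContDiffOn ℝ ∞ (chartRep toFun x₀) (extChartAt (𝓡 n) x₀).target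
  closed : ∀ x₀ : M, ∀ y ∈ (extChartAt (𝓡 n) x₀).target, ∀ u v : EuclideanSpace ℝ (Fin n),
    fderiv ℝ (chartRep toFun x₀) y u v = fderiv ℝ (chartRep toFun x₀) y v u

variable (n) in
/-- A path in the manifold `M` that is `C^∞` on `[0,1]`. -/
def IsSmoothPath {a b : M} (γ : Path a b) : Prop :=
  ContMDiffOn 𝓘(ℝ, ℝ) (𝓡 n) ∞ γ.extend (Icc (0 : ℝ) 1)

/-- The integral `∫_γ η` along a smooth path `γ` in `M`. -/
def ClosedOneForm.pathIntegral (η : ClosedOneForm n M) {a b : M} (γ : Path a b) : ℝ :=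
  ∫ t in (0 : ℝ)..1, η.toFun (γ.extend t)
    (mfderivWithin 𝓘(ℝ, ℝ) (𝓡 n) γ.extend (Icc (0 : ℝ) 1) t (1 : ℝ))

open Classical in
/-- The pairing `η(c)` of a closed one-form with a homology class `c`: the integral of `η` along a
smooth loop in the class `c`. -/
def ClosedOneForm.period (η : ClosedOneForm n M) (c : H1 M) : ℝ :=
  if h : ∃ l : (a : M) × Path a a, IsSmoothPath n l.2 ∧
      loopClass (l.2 : C(I, M)) (by simp) = c then
    η.pathIntegral h.choose.2
  else 0

/-- The one-forms `η₁, …, η_b` are dual to the basis `Γ₁, …, Γ_b` of `H₁(M; ℤ)`: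
`η_i(Γ_j) = δ_ij`. -/
def IsDualTo {b : ℕ} (η : Fin b → ClosedOneForm n M) (Γ : Module.Basis (Fin b) ℤ (H1 M)) : Prop :=
  ∀ i j, (η i).period (Γ j) = if i = j then 1 else 0

end Forms

/-! ### The universal Abelian cover -/

section Cover

variable {M : Type u} [TopologicalSpace M] {Mt : Type v} [TopologicalSpace Mt]

/-- `p : Mt → M` is the universal Abelian cover of `M`: a path-connected covering whose fundamental
group is, as a subgroup of the fundamental group of `M`, the commutator subgroup. -/
structure IsUniversalAbelianCover (p : C(Mt, M)) : Prop where
  isCoveringMap : IsCoveringMap p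
  pathConnected : PathConnectedSpace Mt
  range_eq : ∀ x : Mt, (FundamentalGroup.map p x).range = commutator (FundamentalGroup M (p x))

variable {b : ℕ} (Γ : Module.Basis (Fin b) ℤ (H1 M)) (p : C(Mt, M))

open Classical in
/-- The deck transformation `δ_v` for `v ∈ ℤ^b`: it moves `x` to the end point of any path which
starts at `x` and projects to a closed loop in `M` of homology class `∑ v_j Γ_j`. -/
def deck (v : Fin b → ℤ) (x : Mt) : Mt :=
  if h : ∃ y : Mt, ∃ (γ : Path x y) (hy : p x = p y),
      loopClass ((γ.map p.continuous : Path (p x) (p y)) : C(I, M)) (by simp [hy]) =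
        ∑ j, v j • Γ j then
    h.choose
  else x

/-- `M₀` is a connected, relatively compact fundamental domain for the action of `ℤ^b` by deck
transformations: its translates `δ_v M₀` partition the cover. -/
structure IsFundamentalDomain (M₀ : Set Mt) : Prop where
  isConnected : IsConnected M₀
  isCompact_closure : IsCompact (closure M₀)
  iUnion_eq : ⋃ v : Fin b → ℤ, deck Γ p v '' M₀ = univ
  pairwise_disjoint : Pairwise fun v w : Fin b → ℤ => Disjoint (deck Γ p v '' M₀) (deck Γ p w '' M₀)

open Classical in
/-- The index `⌊x⌋ ∈ ℤ^b` of the tile `δ_v M₀` containing `x`. -/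
def tileIndex (M₀ : Set Mt) (x : Mt) : Fin b → ℤ :=
  if h : ∃ v : Fin b → ℤ, x ∈ deck Γ p v '' M₀ then h.choose else 0

/-- The approximate displacement `d_k(x) = ⌊f̃^k(x)⌋ - ⌊x⌋ ∈ ℤ^b`. -/
def displacement (M₀ : Set Mt) (ft : C(Mt, Mt)) (k : ℕ) (x : Mt) : Fin b → ℤ :=
  tileIndex Γ p M₀ (ft^[k] x) - tileIndex Γ p M₀ x

end Cover

/-! ### The maps `ι̃`, `β̃` and `β` -/

section Beta

variable {n b : ℕ} {M : Type u} [TopologicalSpace M] [ChartedSpace (EuclideanSpace ℝ (Fin n)) M]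
  {Mt : Type v} [TopologicalSpace Mt]

open Classical in
/-- The map `ι̃ : Mt → ℝ^b`, whose `i`-th coordinate at `x` is the integral of the lift of `η_i`
along a smooth path from `x₀` to `x`. The cover carries the smooth structure pulled back from `M`,
so that a path is smooth if and only if its projection is, and the integral of the lifted form
along it is the integral of the form along the projected path. -/
def abelJacobi (p : C(Mt, M)) (η : Fin b → ClosedOneForm n M) (x₀ x : Mt) : Fin b → ℝ := fun i =>
  if h : ∃ γ : Path x₀ x, IsSmoothPath n (γ.map p.continuous) then
    (η i).pathIntegral (h.choose.map p.continuous)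
  else 0

/-- The real matrix with the same entries as an integer matrix. -/
abbrev realMatrix (A : Matrix (Fin b) (Fin b) ℤ) : Matrix (Fin b) (Fin b) ℝ :=
  A.map (Int.cast : ℤ → ℝ)

/-- A matrix is expanding if all its (complex) eigenvalues lie outside the closed unit disc. -/
def IsExpanding (A : Matrix (Fin b) (Fin b) ℤ) : Prop :=
  ∀ μ : ℂ, Module.End.HasEigenvalue (Matrix.toLin' (A.map (Int.cast : ℤ → ℂ))) μ → 1 < ‖μ‖

/-- The map `β̃ = lim A^{-k} ι̃ f̃^k`. -/
def betaLift (A : Matrix (Fin b) (Fin b) ℤ) (p : C(Mt, M)) (η : Fin b → ClosedOneForm n M)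
    (x₀ : Mt) (ft : C(Mt, Mt)) (x : Mt) : Fin b → ℝ :=
  limUnder atTop fun k : ℕ => ((realMatrix A) ^ k)⁻¹.mulVec (abelJacobi p η x₀ (ft^[k] x))

/-- The torus `𝕋^b = (ℝ/ℤ)^b`. -/
abbrev Torus (b : ℕ) : Type := Fin b → UnitAddCircle

/-- The projection `ℝ^b → 𝕋^b`. -/
def toTorus (v : Fin b → ℝ) : Torus b := fun i => (v i : UnitAddCircle)

/-- The toral endomorphism `Φ_A` induced by an integer matrix `A`. -/
def toralEndo (A : Matrix (Fin b) (Fin b) ℤ) (θ : Torus b) : Torus b :=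
  fun i => ∑ j, A i j • θ j

open Classical in
/-- The map `β : M → 𝕋^b` to which `β̃` descends: `β(x)` is the projection of `β̃(x̃)` for a lift
`x̃` of `x`. -/
def beta (A : Matrix (Fin b) (Fin b) ℤ) (p : C(Mt, M)) (η : Fin b → ClosedOneForm n M)
    (x₀ : Mt) (ft : C(Mt, Mt)) (x : M) : Torus b :=
  if h : ∃ xt : Mt, p xt = x then toTorus (betaLift A p η x₀ ft h.choose) else 0

end Beta

end AbelianCover

end

/-!
Integrating a smooth closed one-form over a smooth path only involves its local primitives, and a
family of local primitives whose differences are locally constant can be integrated over every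
continuous path. The integral is invariant under homotopy, and over loops it only depends on the
homology class. Since the forms are dual to `Γ`, the Abel-Jacobi map `ι̃` is therefore continuous
and equivariant: it adds `v` when a point is translated by a loop of class `∑ v_j Γ_j`.

As `f̃` takes translates by `v` to translates by `A v`, the function `u = A⁻¹ ι̃ f̃ - ι̃` is
constant on the fibres of `p`, hence bounded because `M` is compact. The norms of the `A^{-k}` are
summable by Gelfand's formula, so the right-hand side of the telescoping identity
`A^{-k} ι̃ f̃^k = ι̃ + ∑_{j<k} A^{-j} u f̃^j` converges uniformly, and its limit `β̃` is again
continuous and equivariant.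

A bounded perturbation of `ι̃` does not change the limit. Two choices of forms and base points
give Abel-Jacobi maps at bounded distance, hence the same `β̃`; and `ι̃` is at bounded distance
from the index of the tile, hence `A^{-k} d_k → β̃`. The vectors `q = (A^k - 1)⁻¹ d_k` have the
same limit, because `q - A^{-k} q = A^{-k} d_k`.
-/

noncomputable section

namespace AbelianCover

universe u v

/-! ### Local potentials and their primitives -/

instance : ContractibleSpace I := (convex_Icc 0 1).contractibleSpace ⟨0, unitInterval.zero_mem⟩

instance : LocallyPathConnectedSpace I := (convex_Icc (0 : ℝ) 1).locallyPathConnectedSpace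

/-- A closed one-form on a topological space `X` with values in `G`, in the sense of Farber: a
family of functions on the members of an open cover of `X`, any two of which differ by a locally
constant function. The cover is indexed by the points of `X`. -/
structure LocalPotential (X G : Type*) [TopologicalSpace X] [AddCommGroup G] where
  /-- the domain of the potential around a point -/
  baseSet : X → Set X
  /-- the potential around a point -/
  potential : X → X → G
  isOpen_baseSet : ∀ x, IsOpen (baseSet x)
  mem_baseSet : ∀ x, x ∈ baseSet x
  eventually_sub_eq : ∀ i j, ∀ x ∈ baseSet i ∩ baseSet j,
    ∀ᶠ y in 𝓝 x, potential i y - potential j y = potential i x - potential j x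

namespace LocalPotential

variable {X Y Z G : Type*} [TopologicalSpace X] [TopologicalSpace Y] [TopologicalSpace Z]
  [AddCommGroup G] (P : LocalPotential X G)

/-- `F` is a primitive of the local potential along the map `φ`. -/
def IsPrimitive (φ : Y → X) (F : Y → G) : Prop :=
  ∀ y i, φ y ∈ P.baseSet i →
    ∀ᶠ z in 𝓝 y, F z - F y = P.potential i (φ z) - P.potential i (φ y)

variable {P}

theorem IsPrimitive.of_exists {φ : Y → X} (hφ : Continuous φ) {F : Y → G}
    (hF : ∀ y, ∃ i, φ y ∈ P.baseSet i ∧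
      ∀ᶠ z in 𝓝 y, F z - F y = P.potential i (φ z) - P.potential i (φ y)) :
    P.IsPrimitive φ F := by
  intro y j hj
  obtain ⟨i, hi, h⟩ := hF y
  filter_upwards [h, hφ.continuousAt.eventually (P.eventually_sub_eq i j _ ⟨hi, hj⟩)] with z h₁ h₂
  rw [h₁]
  exact sub_eq_sub_iff_sub_eq_sub.1 h₂

theorem IsPrimitive.comp {φ : Y → X} {F : Y → G} (hF : P.IsPrimitive φ F) {α : Z → Y}
    (hα : Continuous α) : P.IsPrimitive (φ ∘ α) (F ∘ α) :=
  fun z i hi => hα.continuousAt.eventually (hF (α z) i hi)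

theorem IsPrimitive.sub_eq_sub [PreconnectedSpace Y] {φ : Y → X} {F F' : Y → G}
    (hF : P.IsPrimitive φ F) (hF' : P.IsPrimitive φ F') (y z : Y) : F z - F y = F' z - F' y := by
  have hloc : IsLocallyConstant (F - F') := by
    refine (IsLocallyConstant.iff_eventually_eq _).2 fun y => ?_
    filter_upwards [hF y _ (P.mem_baseSet _), hF' y _ (P.mem_baseSet _)] with z h h'
    exact sub_eq_sub_iff_sub_eq_sub.1 (h.trans h'.symm)
  exact sub_eq_sub_iff_sub_eq_sub.1
    (hloc.apply_eq_of_isPreconnected isPreconnected_univ (mem_univ z) (mem_univ y))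

section GermCover

variable [TopologicalSpace G] [DiscreteTopology G]

variable (P) in
/-- The covering space of germs of primitives of `P`. In the coordinate given by `i`, the germ of
`P.potential i + c` at a point of `P.baseSet i` has fiber coordinate `c`. -/
def germBundle : FiberBundleCore X X G where
  baseSet := P.baseSet
  isOpen_baseSet := P.isOpen_baseSet
  indexAt := id
  mem_baseSet_at := P.mem_baseSet
  coordChange i j x c := c + (P.potential i x - P.potential j x)
  coordChange_self i x _ c := by rw [sub_self, add_zero]
  continuousOn_coordChange i j := by
    rintro ⟨x, c⟩ ⟨hx, -⟩
    refine ContinuousAt.continuousWithinAt ?_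
    have hconst : ∀ᶠ q : X × G in 𝓝 (x, c), c + (P.potential i x - P.potential j x) =
        q.2 + (P.potential i q.1 - P.potential j q.1) := by
      filter_upwards [continuousAt_fst.eventually (P.eventually_sub_eq i j x hx),
        continuousAt_snd.eventually ((isOpen_discrete {c}).mem_nhds rfl)] with q hq₁ hq₂
      exact congrArg₂ (· + ·) hq₂.symm hq₁.symm
    exact continuousAt_const.congr hconst
  coordChange_comp i j k x _ c := by rw [add_assoc, sub_add_sub_cancel]

variable (P) in
theorem isCoveringMap_germBundle : IsCoveringMap P.germBundle.proj :=
  FiberBundle.isCoveringMap (E := P.germBundle.Fiber)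

/-- The value at `x` of a germ of a primitive at `x`. -/
def germValue (e : P.germBundle.TotalSpace) : G := (show G from e.2) + P.potential e.1 e.1

theorem isPrimitive_germValue : P.IsPrimitive P.germBundle.proj germValue := by
  refine .of_exists P.germBundle.continuous_proj fun e => ?_
  let φ := P.germBundle.localTriv e.1
  have he : e ∈ φ.source := (P.germBundle.mem_localTriv_source _ _).2 (P.mem_baseSet e.1)
  have hφ : ∀ᶠ e' in 𝓝 e, (φ e').2 = (φ e).2 :=
    (φ.continuousAt he).snd.eventually (isOpen_discrete {(φ e).2} |>.mem_nhds rfl)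
  have hval (e' : P.germBundle.TotalSpace) :
      (φ e').2 = germValue e' - P.potential e.1 e'.1 :=
    (add_sub_assoc (show G from e'.2) _ _).symm
  refine ⟨e.1, P.mem_baseSet _, hφ.mono fun e' he' => ?_⟩
  rw [hval, hval] at he'
  exact sub_eq_sub_iff_sub_eq_sub.1 he'

end GermCover

variable (P)

theorem exists_isPrimitive [SimplyConnectedSpace Y] [LocallyPathConnectedSpace Y] (φ : C(Y, X)) :
    ∃ F : Y → G, P.IsPrimitive φ F := by
  let _ : TopologicalSpace G := ⊥
  have : DiscreteTopology G := ⟨rfl⟩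
  obtain ⟨y⟩ : Nonempty Y := inferInstance
  obtain ⟨Φ, ⟨-, hΦ⟩, -⟩ := P.isCoveringMap_germBundle.existsUnique_continuousMap_lifts φ y
    ⟨φ y, (0 : G)⟩ rfl
  exact ⟨germValue ∘ Φ, hΦ ▸ isPrimitive_germValue.comp Φ.continuous⟩

/-- The integral of a local potential along a continuous curve. -/
def integral (γ : C(I, X)) : G :=
  (P.exists_isPrimitive γ).choose 1 - (P.exists_isPrimitive γ).choose 0

variable {P}

theorem IsPrimitive.integral_eq {γ : C(I, X)} {F : I → G} (hF : P.IsPrimitive γ F) :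
    P.integral γ = F 1 - F 0 :=
  (P.exists_isPrimitive γ).choose_spec.sub_eq_sub hF 0 1

theorem IsPrimitive.integral_comp {φ : C(Y, X)} {F : Y → G} (hF : P.IsPrimitive φ F)
    (γ : C(I, Y)) : P.integral (φ.comp γ) = F (γ 1) - F (γ 0) :=
  IsPrimitive.integral_eq (γ := φ.comp γ) (hF.comp γ.continuous)

theorem integral_eq_germValue_monodromy [TopologicalSpace G] [DiscreteTopology G] {x y : X}
    (γ : Path x y) (e : P.germBundle.proj ⁻¹' {x}) :
    P.integral γ =
      germValue (P.isCoveringMap_germBundle.monodromy (.mk γ) e).1 - germValue e.1 := by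
  have hγ : (γ : C(I, X)) 0 = P.germBundle.proj e.1 := γ.source.trans e.2.symm
  have hF := (isPrimitive_germValue (P := P)).comp
    (P.isCoveringMap_germBundle.liftPath γ e.1 hγ).continuous
  rw [P.isCoveringMap_germBundle.liftPath_lifts γ e.1 hγ] at hF
  rw [hF.integral_eq]
  exact congrArg (germValue (P.isCoveringMap_germBundle.liftPath γ e.1 hγ 1) - germValue ·)
    (P.isCoveringMap_germBundle.liftPath_zero γ e.1 hγ)

variable (P)

theorem integral_eq_of_homotopic {x y : X} {γ γ' : Path x y} (h : γ.Homotopic γ') :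
    P.integral γ = P.integral γ' := by
  let _ : TopologicalSpace G := ⊥
  have : DiscreteTopology G := ⟨rfl⟩
  rw [integral_eq_germValue_monodromy γ ⟨⟨x, (0 : G)⟩, rfl⟩,
    integral_eq_germValue_monodromy γ' ⟨⟨x, (0 : G)⟩, rfl⟩,
    Path.Homotopic.Quotient.eq.2 h]

theorem integral_trans {x y z : X} (γ : Path x y) (γ' : Path y z) :
    P.integral (γ.trans γ') = P.integral γ + P.integral γ' := by
  let _ : TopologicalSpace G := ⊥
  have : DiscreteTopology G := ⟨rfl⟩
  let e : P.germBundle.proj ⁻¹' {x} := ⟨⟨x, (0 : G)⟩, rfl⟩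
  rw [integral_eq_germValue_monodromy (γ.trans γ') e, Path.Homotopic.Quotient.mk_trans,
    IsCoveringMap.monodromy_trans_apply, integral_eq_germValue_monodromy γ e,
    integral_eq_germValue_monodromy γ', add_comm, sub_add_sub_cancel]

theorem integral_refl (x : X) : P.integral (Path.refl x) = 0 := by
  have h := P.integral_trans (.refl x) (.refl x)
  rwa [Path.refl_trans_refl, left_eq_add] at h

theorem integral_symm {x y : X} (γ : Path x y) : P.integral γ.symm = -P.integral γ := by
  have h := P.integral_eq_of_homotopic (γ := .refl x) ⟨.reflTransSymm γ⟩
  rw [integral_trans, integral_refl] at h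
  exact eq_neg_of_add_eq_zero_right h.symm

/-- Integration of a local potential, as a homomorphism on the fundamental group. -/
def fundamentalGroupHom (x : X) : FundamentalGroup X x →* Multiplicative G where
  toFun := Quotient.lift (fun γ : Path x x => Multiplicative.ofAdd (P.integral γ))
    fun _ _ h => congrArg _ (P.integral_eq_of_homotopic h)
  map_one' := congrArg Multiplicative.ofAdd (P.integral_refl x)
  map_mul' a b := by
    induction a using Path.Homotopic.Quotient.ind with | _ a
    induction b using Path.Homotopic.Quotient.ind with | _ b
    exact congrArg Multiplicative.ofAdd ((P.integral_trans b a).trans (add_comm _ _))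

theorem integral_map_eq_of_range_le {p : C(Y, X)} {x y : Y}
    (hp : (FundamentalGroup.map p x).range ≤ commutator (FundamentalGroup X (p x)))
    (γ γ' : Path x y) :
    P.integral (γ.map p.continuous) = P.integral (γ'.map p.continuous) := by
  have hker := Abelianization.commutator_subset_ker (P.fundamentalGroupHom (p x))
    (hp ⟨FundamentalGroup.fromPath (.mk (γ.trans γ'.symm)), rfl⟩)
  have h : P.integral ((γ.trans γ'.symm).map p.continuous) = 0 :=
    congrArg Multiplicative.toAdd hker
  rw [Path.map_trans, ← Path.map_symm, P.integral_trans, P.integral_symm] at h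
  exact add_neg_eq_zero.1 h

theorem integral_eq_of_forall_mem {γ : C(I, X)} {i : X} (hγ : ∀ t, γ t ∈ P.baseSet i) :
    P.integral γ = P.potential i (γ 1) - P.potential i (γ 0) :=
  IsPrimitive.integral_eq (F := P.potential i ∘ γ) <| .of_exists γ.continuous fun t =>
    ⟨i, hγ t, .of_forall fun _ => rfl⟩

theorem isPrimitive_of_forall_integral_map_eq [LocallyPathConnectedSpace Y] {φ : C(Y, X)}
    {F : Y → G} (hF : ∀ (y z : Y) (γ : Path y z), P.integral (γ.map φ.continuous) = F z - F y) :
    P.IsPrimitive φ F := by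
  refine .of_exists φ.continuous fun y => ⟨φ y, P.mem_baseSet _, ?_⟩
  obtain ⟨W, ⟨hWy, hW⟩, hWP⟩ := (path_connected_basis y).mem_iff.1
    (((P.isOpen_baseSet (φ y)).preimage φ.continuous).mem_nhds (P.mem_baseSet _))
  filter_upwards [hWy] with z hz
  obtain ⟨γ, hγ⟩ := hW.joinedIn y (mem_of_mem_nhds hWy) z hz
  rw [← hF y z γ, P.integral_eq_of_forall_mem fun t => hWP (hγ t)]
  simp only [ContinuousMap.coe_coe, Path.source, Path.target]

variable {P}

theorem IsPrimitive.continuous [TopologicalSpace G] [IsTopologicalAddGroup G] {φ : Y → X}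
    {F : Y → G} (hF : P.IsPrimitive φ F) (hφ : Continuous φ)
    (hP : ∀ x, ContinuousAt (P.potential x) x) : Continuous F := by
  refine continuous_iff_continuousAt.2 fun y => ?_
  have hcont : ContinuousAt (fun z => P.potential (φ y) (φ z) - P.potential (φ y) (φ y) + F y) y :=
    (((hP (φ y)).comp hφ.continuousAt).sub continuousAt_const).add continuousAt_const
  exact hcont.congr <|
    (hF y _ (P.mem_baseSet _)).mono fun z hz => (sub_eq_iff_eq_add.1 hz).symm

end LocalPotential

/-! ### The pairing of a local potential with first homology -/

section Homology

open CategoryTheory AlgebraicTopology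

variable {X Y : Type u} [TopologicalSpace X] [TopologicalSpace Y]

variable (X) in
/-- The singular simplicial set of `X`. -/
abbrev singularSet : SSet.{u} := TopCat.toSSet.obj (TopCat.of X)

variable (X) in
/-- The integral singular chains of `X`. -/
abbrev singularChains : ChainComplex (ModuleCat.{u} ℤ) ℕ :=
  (singularSet X).chainComplex coeffZ.{u}

/-- The curve underlying a singular `1`-simplex. -/
def simplexCurve (x : singularSet X _⦋1⦌) : C(I, X) :=
  ((TopCat.of X).toSSetObjEquiv _ x).comp
    ⟨stdSimplexHomeomorphUnitInterval.symm, stdSimplexHomeomorphUnitInterval.symm.continuous⟩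

theorem simplexCurve_curveSimplex (γ : C(I, X)) : simplexCurve (curveSimplex γ) = γ := by
  ext t
  simp [simplexCurve, curveSimplex]

theorem curveSimplex_simplexCurve (x : singularSet X _⦋1⦌) :
    curveSimplex (simplexCurve x) = x := by
  apply ((TopCat.of X).toSSetObjEquiv _).injective
  ext t
  simp [simplexCurve, curveSimplex]

/-- The edge opposite to the vertex `i` of the standard `2`-simplex, parametrised by `[0, 1]`. -/
def stdEdge (i : Fin 3) : C(I, stdSimplex ℝ (Fin 3)) :=
  ⟨fun t => stdSimplex.map i.succAbove (stdSimplexHomeomorphUnitInterval.symm t),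
    (stdSimplex.continuous_map _).comp stdSimplexHomeomorphUnitInterval.symm.continuous⟩

theorem stdEdge_zero (i : Fin 3) : stdEdge i 0 = stdSimplex.vertex (i.succAbove 0) := by
  rw [← stdSimplex.map_vertex]
  refine congrArg (stdSimplex.map _) ?_
  rw [Homeomorph.symm_apply_eq, stdSimplexHomeomorphUnitInterval_zero]

theorem stdEdge_one (i : Fin 3) : stdEdge i 1 = stdSimplex.vertex (i.succAbove 1) := by
  rw [← stdSimplex.map_vertex]
  refine congrArg (stdSimplex.map _) ?_
  rw [Homeomorph.symm_apply_eq, stdSimplexHomeomorphUnitInterval_one]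

theorem stdEdge_apply (i : Fin 3) (t : I) (j : Fin 3) : (stdEdge i t).1 j =
    (if i.succAbove 0 = j then 1 - (t : ℝ) else 0) + if i.succAbove 1 = j then (t : ℝ) else 0 := by
  change FunOnFinite.linearMap ℝ ℝ i.succAbove
    (stdSimplexHomeomorphUnitInterval.symm t : Fin 2 → ℝ) j = _
  rw [FunOnFinite.linearMap_apply_apply, Finset.sum_filter, Fin.sum_univ_two]
  rfl

theorem simplexCurve_δ (x : singularSet X _⦋2⦌) (i : Fin 3) :
    simplexCurve ((singularSet X).δ i x) = ((TopCat.of X).toSSetObjEquiv _ x).comp (stdEdge i) :=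
  rfl

/-- A closed curve as a singular cycle. -/
def loopCycle (γ : C(I, X)) (h : γ 0 = γ 1) : coeffZ.{u} ⟶ (singularChains X).cycles 1 :=
  (singularChains X).liftCycles ((singularSet X).ιChainComplex (curveSimplex γ)) 0 (by simp)
    (curveSimplex_d γ h)

section Period

variable {G : Type} [AddCommGroup G] (P : LocalPotential X G)

/-- The homomorphism `ℤ → G` with value `g` at `1`, placed in the universe of the spaces
considered, as an additive function of `g`. -/
def intHom : G →+ (coeffZ.{u} ⟶ ModuleCat.of ℤ (ULift.{u} G)) where
  toFun g := ModuleCat.ofHom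
    (LinearMap.toSpanSingleton ℤ _ (ULift.up g) ∘ₗ ULift.moduleEquiv.toLinearMap)
  map_zero' := by
    ext m
    exact smul_zero m.down
  map_add' g h := by
    ext m
    exact smul_add m.down g h

namespace LocalPotential

/-- Integration of a local potential over singular `1`-chains. -/
def chainIntegral : (singularChains X).X 1 ⟶ ModuleCat.of ℤ (ULift.{u} G) :=
  Limits.Cofan.IsColimit.desc ((singularSet X).isColimitChainComplexXCofan coeffZ.{u} 1)
    fun x => intHom (P.integral (simplexCurve x))

theorem ι_chainIntegral (x : singularSet X _⦋1⦌) :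
    (singularSet X).ιChainComplex x ≫ P.chainIntegral = intHom (P.integral (simplexCurve x)) :=
  Limits.Cofan.IsColimit.fac _ _ x

theorem integral_δ (x : singularSet X _⦋2⦌) :
    P.integral (simplexCurve ((singularSet X).δ 0 x)) -
      P.integral (simplexCurve ((singularSet X).δ 1 x)) +
      P.integral (simplexCurve ((singularSet X).δ 2 x)) = 0 := by
  have := (convex_stdSimplex ℝ (Fin 3)).contractibleSpace ⟨_, (stdSimplex.vertex 0).2⟩
  have := (convex_stdSimplex ℝ (Fin 3)).locallyPathConnectedSpace
  obtain ⟨F, hF⟩ := P.exists_isPrimitive ((TopCat.of X).toSSetObjEquiv _ x)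
  have hδ (i : Fin 3) : P.integral (simplexCurve ((singularSet X).δ i x)) =
      F (stdSimplex.vertex (i.succAbove 1)) - F (stdSimplex.vertex (i.succAbove 0)) := by
    rw [simplexCurve_δ, hF.integral_comp, stdEdge_one, stdEdge_zero]
  rw [hδ, hδ, hδ]
  let v : Fin 3 → stdSimplex ℝ (Fin 3) := stdSimplex.vertex
  change F (v 2) - F (v 1) - (F (v 2) - F (v 0)) + (F (v 1) - F (v 0)) = 0
  abel

theorem d_chainIntegral : (singularChains X).d 2 1 ≫ P.chainIntegral = 0 := by
  refine SSet.chainComplex_hom_ext fun x => ?_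
  rw [SSet.ιChainComplex_d_assoc, Preadditive.sum_comp, Limits.comp_zero]
  simp only [Preadditive.zsmul_comp, ι_chainIntegral, ← map_zsmul, ← map_sum]
  rw [← map_zero intHom, ← P.integral_δ x, Fin.sum_univ_three]
  simp [sub_eq_add_neg]

/-- The pairing of first homology with a local potential. -/
def period : H1 X →ₗ[ℤ] G :=
  ULift.moduleEquiv.toLinearMap ∘ₗ ((singularChains X).homologyι 1 ≫
    (singularChains X).descOpcycles P.chainIntegral 2 (by simp) P.d_chainIntegral).hom

theorem period_loopClass (γ : C(I, X)) (h : γ 0 = γ 1) :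
    P.period (loopClass γ h) = P.integral γ := by
  have key : (loopCycle γ h ≫ (singularChains X).homologyπ 1) ≫ (singularChains X).homologyι 1 ≫
      (singularChains X).descOpcycles P.chainIntegral 2 (by simp) P.d_chainIntegral =
      intHom (P.integral γ) := by
    rw [Category.assoc, HomologicalComplex.homology_π_ι_assoc, HomologicalComplex.p_descOpcycles,
      loopCycle, HomologicalComplex.liftCycles_i_assoc, ι_chainIntegral, simplexCurve_curveSimplex]
  exact (congrArg (fun φ => (φ.hom (ULift.up 1)).down) key).trans (one_zsmul _)

end LocalPotential

end Period

theorem H1map_loopClass (f : C(X, Y)) (γ : C(I, X)) (h : γ 0 = γ 1) :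
    H1map f (loopClass γ h) = loopClass (f.comp γ) (congrArg f h) := by
  have key : (loopCycle γ h ≫ (singularChains X).homologyπ 1) ≫ HomologicalComplex.homologyMap
        (SSet.chainComplexMap (TopCat.toSSet.map (TopCat.ofHom f)) coeffZ.{u}) 1 =
      loopCycle (f.comp γ) (congrArg f h) ≫ (singularChains Y).homologyπ 1 := by
    rw [Category.assoc, HomologicalComplex.homologyπ_naturality, loopCycle,
      HomologicalComplex.liftCycles_comp_cyclesMap_assoc]
    congr 2
    rw [SSet.ι_chainComplexMap_f]
    rfl
  exact congrArg (fun φ => φ.hom (ULift.up 1)) key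

theorem loopClass_face_relation (s : C(stdSimplex ℝ (Fin 3), X))
    (h : ∀ i, s.comp (stdEdge i) 0 = s.comp (stdEdge i) 1) :
    loopClass (s.comp (stdEdge 0)) (h 0) - loopClass (s.comp (stdEdge 1)) (h 1) +
      loopClass (s.comp (stdEdge 2)) (h 2) = 0 := by
  let x : singularSet X _⦋2⦌ := ((TopCat.of X).toSSetObjEquiv _).symm s
  have hx (i : Fin 3) : curveSimplex (s.comp (stdEdge i)) = (singularSet X).δ i x := by
    rw [← curveSimplex_simplexCurve ((singularSet X).δ i x), simplexCurve_δ,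
      Equiv.apply_symm_apply]
  let z (i : Fin 3) := loopCycle (s.comp (stdEdge i)) (h i)
  have hz :
      z 0 - z 1 + z 2 = (singularSet X).ιChainComplex x ≫ (singularChains X).toCycles 2 1 := by
    rw [← cancel_mono ((singularChains X).iCycles 1)]
    simp only [z, loopCycle, Preadditive.add_comp, Preadditive.sub_comp,
      HomologicalComplex.liftCycles_i, Category.assoc, HomologicalComplex.toCycles_i, hx]
    rw [SSet.ιChainComplex_d, Fin.sum_univ_three]
    simp [sub_eq_add_neg]
  have key : (z 0 - z 1 + z 2) ≫ (singularChains X).homologyπ 1 = 0 := by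
    rw [hz, Category.assoc, HomologicalComplex.toCycles_comp_homologyπ, Limits.comp_zero]
  rw [Preadditive.add_comp, Preadditive.sub_comp] at key
  exact congrArg (fun φ => φ.hom (ULift.up 1)) key

theorem loopClass_const (x : X) : loopClass (ContinuousMap.const I x) rfl = 0 := by
  have h := loopClass_face_relation (ContinuousMap.const _ x) fun _ => rfl
  exact (sub_add_cancel _ _).symm.trans h

theorem loopClass_symm {x : X} (γ : Path x x) :
    loopClass (γ.symm : C(I, X)) (by simp) = -loopClass (γ : C(I, X)) (by simp) := by
  -- The faces of the degenerate `2`-simplex `z ↦ γ z₁` are `γ⁻¹`, a constant loop and `γ`.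
  let s : C(stdSimplex ℝ (Fin 3), X) :=
    ⟨fun z => γ ⟨z.1 1, z.2.1 1, stdSimplex.le_one z 1⟩, γ.continuous.comp
      (((continuous_apply 1).comp continuous_subtype_val).subtype_mk _)⟩
  have hs (i : Fin 3) (t : I) : s (stdEdge i t) = γ.extend ((stdEdge i t).1 1) :=
    (γ.extend_apply _).symm
  have face₀ : s.comp (stdEdge 0) = γ.symm := by
    ext t
    rw [ContinuousMap.comp_apply, hs, stdEdge_apply]
    suffices γ.extend (1 - t) = γ (unitInterval.symm t) by simpa [Fin.succAbove] using this
    exact γ.extend_apply (unitInterval.symm t).2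
  have face₁ : s.comp (stdEdge 1) = ContinuousMap.const I x := by
    ext t
    rw [ContinuousMap.comp_apply, hs, stdEdge_apply]
    simp [Fin.succAbove]
  have face₂ : s.comp (stdEdge 2) = γ := by
    ext t
    rw [ContinuousMap.comp_apply, hs, stdEdge_apply]
    simp [Fin.succAbove]
  have h := loopClass_face_relation s fun i => by
    fin_cases i <;> simp [face₀, face₁, face₂]
  simp only [face₀, face₁, face₂, loopClass_const, sub_zero] at h
  exact eq_neg_of_add_eq_zero_left h

end Homology

/-! ### Closed one-forms as local potentials -/

section Charts

variable {E H M : Type*} [NormedAddCommGroup E] [NormedSpace ℝ E] [TopologicalSpace H]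
  {J : ModelWithCorners ℝ E H} [TopologicalSpace M] [ChartedSpace H M]

theorem eventually_extChartAt_mem_ball (x : M) {r : ℝ} (hr : 0 < r) :
    ∀ᶠ y in 𝓝 x, y ∈ (extChartAt J x).source ∧
      extChartAt J x y ∈ Metric.ball (extChartAt J x x) r :=
  inter_mem (extChartAt_source_mem_nhds x)
    ((continuousAt_extChartAt x).preimage_mem_nhds (Metric.ball_mem_nhds _ hr))

variable [J.Boundaryless]

theorem exists_ball_subset_extChartAt_target {x : M} {V : Set M} (hV : V ∈ 𝓝 x) :
    ∃ r > 0, ∀ z ∈ Metric.ball (extChartAt J x x) r,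
      z ∈ (extChartAt J x).target ∧ (extChartAt J x).symm z ∈ V := by
  have hsymm : ∀ᶠ z in 𝓝 (extChartAt J x x), (extChartAt J x).symm z ∈ V :=
    (continuousAt_extChartAt_symm x).eventually_mem (by rwa [extChartAt_to_inv])
  exact Metric.eventually_nhds_iff_ball.1 (hsymm.and (extChartAt_target_mem_nhds x)) |>.imp
    fun r hr => ⟨hr.1, fun z hz => (hr.2 z hz).symm⟩

theorem eventually_eq_of_hasMFDerivAt_zero [IsManifold J 1 M] {F : Type*} [NormedAddCommGroup F]
    [NormedSpace ℝ F] {f : M → F} {x : M} (hf : ∀ᶠ y in 𝓝 x, HasMFDerivAt J 𝓘(ℝ, F) f y 0) :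
    ∀ᶠ y in 𝓝 x, f y = f x := by
  obtain ⟨r, hr, hball⟩ := exists_ball_subset_extChartAt_target (J := J) hf
  have hderiv (z) (hz : z ∈ Metric.ball (extChartAt J x x) r) :
      HasFDerivAt (𝕜 := ℝ) (f ∘ (extChartAt J x).symm) 0 z := by
    have hsymm := mdifferentiableWithinAt_extChartAt_symm (hball z hz).1
    rw [J.range_eq_univ, mdifferentiableWithinAt_univ] at hsymm
    exact ((((hball z hz).2 : HasMFDerivAt J 𝓘(ℝ, F) f _ 0).comp z hsymm.hasMFDerivAt).congr_mfderiv
      (ContinuousLinearMap.zero_comp _)).hasFDerivAt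
  filter_upwards [eventually_extChartAt_mem_ball (J := J) x hr] with y ⟨hy, hyr⟩
  have hconst := Metric.isOpen_ball.is_const_of_fderiv_eq_zero
    (convex_ball (extChartAt J x x) r).isPreconnected
    (fun z hz => (hderiv z hz).differentiableAt.differentiableWithinAt)
    (fun z hz => (hderiv z hz).fderiv) hyr (Metric.mem_ball_self hr)
  rwa [Function.comp_apply, Function.comp_apply, (extChartAt J x).left_inv hy,
    extChartAt_to_inv] at hconst

theorem eventually_exists_contMDiff_curve [IsManifold J ∞ M] {x : M} {V : Set M} (hV : V ∈ 𝓝 x) :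
    ∀ᶠ y in 𝓝 x, ∃ c : ℝ → M, ContMDiff 𝓘(ℝ, ℝ) J ∞ c ∧ (∀ t, c t ∈ V) ∧
      (∀ t ≤ 0, c t = x) ∧ ∀ t ≥ 1, c t = y := by
  obtain ⟨r, hr, hball⟩ := exists_ball_subset_extChartAt_target (J := J) hV
  filter_upwards [eventually_extChartAt_mem_ball (J := J) x hr] with y ⟨hy, hyr⟩
  let l : ℝ → E := fun t =>
    AffineMap.lineMap (extChartAt J x x) (extChartAt J x y) (Real.smoothTransition t)
  have hl (t : ℝ) : l t ∈ Metric.ball (extChartAt J x x) r :=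
    (convex_ball _ r).lineMap_mem (Metric.mem_ball_self hr) hyr
      ⟨Real.smoothTransition.nonneg t, Real.smoothTransition.le_one t⟩
  have hsmooth : ContDiff ℝ ∞ l := by
    simp only [l, AffineMap.lineMap_apply, vsub_eq_sub, vadd_eq_add]
    exact (Real.smoothTransition.contDiff.smul contDiff_const).add contDiff_const
  refine ⟨(extChartAt J x).symm ∘ l, contMDiffOn_univ.1 <|
      (contMDiffOn_extChartAt_symm (n := ∞) x).comp hsmooth.contMDiff.contMDiffOn
        fun t _ => (hball _ (hl t)).1,
    fun t => (hball _ (hl t)).2, fun t ht => ?_, fun t ht => ?_⟩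
  · simp only [l, Function.comp_apply, Real.smoothTransition.zero_of_nonpos ht,
      AffineMap.lineMap_apply_zero, extChartAt_to_inv]
  · simp only [l, Function.comp_apply, Real.smoothTransition.one_of_one_le ht,
      AffineMap.lineMap_apply_one, (extChartAt J x).left_inv hy]

end Charts

section Forms

variable {n : ℕ} {M : Type u} [TopologicalSpace M] [ChartedSpace (EuclideanSpace ℝ (Fin n)) M]
  [IsManifold (𝓡 n) 1 M]

theorem chartRep_comp_mfderiv (η : (x : M) → TangentSpace (𝓡 n) x →L[ℝ] ℝ) (x₀ : M) {y : M}
    (hy : y ∈ (extChartAt (𝓡 n) x₀).source) :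
    (chartRep η x₀ (extChartAt (𝓡 n) x₀ y)).comp
      (mfderiv (𝓡 n) 𝓘(ℝ, EuclideanSpace ℝ (Fin n)) (extChartAt (𝓡 n) x₀) y) = η y := by
  have hchart := mfderivWithin_extChartAt_symm_comp_mfderiv_extChartAt' hy
  rw [ModelWithCorners.range_eq_univ, mfderivWithin_univ] at hchart
  have hη (z : M) (hz : z = y) : (show EuclideanSpace ℝ (Fin n) →L[ℝ] ℝ from η z) = η y := by
    rw [hz]
  have hηy := hη _ ((extChartAt (𝓡 n) x₀).left_inv hy)
  refine (ContinuousLinearMap.comp_assoc _ _ _).trans ?_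
  ext v
  exact (congrArg _ (DFunLike.congr_fun hchart v)).trans (DFunLike.congr_fun hηy v)

namespace ClosedOneForm

variable (η : ClosedOneForm n M)

theorem exists_hasMFDerivAt (x₀ : M) :
    ∃ (U : Set M) (h : M → ℝ), IsOpen U ∧ x₀ ∈ U ∧ ∀ y ∈ U,
      HasMFDerivAt (𝓡 n) 𝓘(ℝ, ℝ) h y (η.toFun y) ∧ ContMDiffAt (𝓡 n) 𝓘(ℝ, ℝ) 1 h y := by
  let φ : PartialEquiv M (EuclideanSpace ℝ (Fin n)) := extChartAt (𝓡 n) x₀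
  obtain ⟨r, hr, hball⟩ := Metric.isOpen_iff.1 (isOpen_extChartAt_target x₀ : IsOpen φ.target) _
    (mem_extChartAt_target x₀)
  have hsmooth := (η.smooth x₀).mono hball
  -- The Poincaré lemma in a coordinate ball.
  obtain ⟨h, hh⟩ := (convex_ball (φ x₀) r).exists_forall_hasFDerivAt_of_fderiv_symmetric
    Metric.isOpen_ball (hsmooth.differentiableOn (by simp)) fun y hy => η.closed x₀ y (hball hy)
  have hC1 : ContDiffOn ℝ 1 h (Metric.ball (φ x₀) r) := by
    rw [← zero_add 1, contDiffOn_succ_iff_fderiv_of_isOpen Metric.isOpen_ball, contDiffOn_zero]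
    exact ⟨fun y hy => (hh y hy).differentiableAt.differentiableWithinAt, by simp,
      hsmooth.continuousOn.congr fun y hy => (hh y hy).fderiv⟩
  refine ⟨φ.source ∩ φ ⁻¹' Metric.ball (φ x₀) r, h ∘ φ,
    (continuousOn_extChartAt x₀).isOpen_inter_preimage (isOpen_extChartAt_source x₀)
      Metric.isOpen_ball, ⟨mem_extChartAt_source x₀, Metric.mem_ball_self hr⟩, ?_⟩
  rintro y ⟨hy, hyr⟩
  have hy' : y ∈ (chartAt (EuclideanSpace ℝ (Fin n)) x₀).source := by
    rwa [← extChartAt_source (𝓡 n)]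
  refine ⟨?_, (hC1.contDiffAt (Metric.isOpen_ball.mem_nhds hyr)).contMDiffAt.comp y
    (contMDiffAt_extChartAt' hy')⟩
  have hcomp := (hh _ hyr).hasMFDerivAt.comp y (mdifferentiableAt_extChartAt hy').hasMFDerivAt
  exact hcomp.congr_mfderiv (chartRep_comp_mfderiv η.toFun x₀ hy)

/-- The local primitives of a closed one-form. -/
def potential : LocalPotential M ℝ where
  baseSet x := (η.exists_hasMFDerivAt x).choose
  potential x := (η.exists_hasMFDerivAt x).choose_spec.choose
  isOpen_baseSet x := (η.exists_hasMFDerivAt x).choose_spec.choose_spec.1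
  mem_baseSet x := (η.exists_hasMFDerivAt x).choose_spec.choose_spec.2.1
  eventually_sub_eq i j x hx := by
    obtain ⟨hUi, -, hi⟩ := (η.exists_hasMFDerivAt i).choose_spec.choose_spec
    obtain ⟨hUj, -, hj⟩ := (η.exists_hasMFDerivAt j).choose_spec.choose_spec
    refine eventually_eq_of_hasMFDerivAt_zero (J := 𝓡 n) (f := fun y => _ - _) ?_
    filter_upwards [hUi.mem_nhds hx.1, hUj.mem_nhds hx.2] with y hyi hyj
    exact ((hi y hyi).1.sub (hj y hyj).1).congr_mfderiv (sub_self _)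

variable {η}

theorem hasMFDerivAt_potential {x y : M} (hy : y ∈ η.potential.baseSet x) :
    HasMFDerivAt (𝓡 n) 𝓘(ℝ, ℝ) (η.potential.potential x) y (η.toFun y) :=
  ((η.exists_hasMFDerivAt x).choose_spec.choose_spec.2.2 y hy).1

theorem contMDiffAt_potential {x y : M} (hy : y ∈ η.potential.baseSet x) :
    ContMDiffAt (𝓡 n) 𝓘(ℝ, ℝ) 1 (η.potential.potential x) y :=
  ((η.exists_hasMFDerivAt x).choose_spec.choose_spec.2.2 y hy).2

theorem eventuallyEq_IccExtend_of_isPrimitive {a b : M} {γ : Path a b} {F : I → ℝ}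
    (hF : η.potential.IsPrimitive γ F) {t : ℝ} (ht : t ∈ Icc (0 : ℝ) 1) :
    IccExtend (zero_le_one' ℝ) F =ᶠ[𝓝[Icc 0 1] t] fun s =>
      F ⟨t, ht⟩ - η.potential.potential (γ ⟨t, ht⟩) (γ ⟨t, ht⟩) +
        η.potential.potential (γ ⟨t, ht⟩) (γ.extend s) := by
  have hprim := hF ⟨t, ht⟩ _ (η.potential.mem_baseSet _)
  rw [nhds_subtype_eq_comap, eventually_comap] at hprim
  filter_upwards [mem_nhdsWithin_of_mem_nhds hprim, self_mem_nhdsWithin] with s hs hsI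
  have := hs ⟨s, hsI⟩ rfl
  rw [IccExtend_of_mem _ _ hsI, γ.extend_apply hsI]
  linarith

theorem contDiffOn_IccExtend_of_isPrimitive {a b : M} {γ : Path a b} (hγ : IsSmoothPath n γ)
    {F : I → ℝ} (hF : η.potential.IsPrimitive γ F) :
    ContDiffOn ℝ 1 (IccExtend (zero_le_one' ℝ) F) (Icc 0 1) := by
  intro t ht
  have hcomp : ContMDiffWithinAt 𝓘(ℝ, ℝ) 𝓘(ℝ, ℝ) 1
      (η.potential.potential (γ ⟨t, ht⟩) ∘ γ.extend) (Icc 0 1) t :=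
    (contMDiffAt_potential (by
      rw [γ.extend_apply ht]
      exact η.potential.mem_baseSet _)).comp_contMDiffWithinAt t ((hγ t ht).of_le (by simp))
  have heq := eventuallyEq_IccExtend_of_isPrimitive hF ht
  exact (contDiffWithinAt_const.add hcomp.contDiffWithinAt).congr_of_eventuallyEq heq
    (heq.self_of_nhdsWithin ht)

theorem derivWithin_IccExtend_of_isPrimitive {a b : M} {γ : Path a b} (hγ : IsSmoothPath n γ)
    {F : I → ℝ} (hF : η.potential.IsPrimitive γ F) {t : ℝ} (ht : t ∈ Icc (0 : ℝ) 1) :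
    derivWithin (IccExtend (zero_le_one' ℝ) F) (Icc 0 1) t =
      η.toFun (γ.extend t) (mfderivWithin 𝓘(ℝ, ℝ) (𝓡 n) γ.extend (Icc (0 : ℝ) 1) t (1 : ℝ)) := by
  have hmem : γ.extend t ∈ η.potential.baseSet (γ ⟨t, ht⟩) := by
    rw [γ.extend_apply ht]
    exact η.potential.mem_baseSet _
  have hcomp := (hasMFDerivAt_potential hmem).comp_hasMFDerivWithinAt t
    ((hγ t ht).mdifferentiableWithinAt (by simp)).hasMFDerivWithinAt
  have heq := eventuallyEq_IccExtend_of_isPrimitive hF ht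
  exact ((hcomp.hasFDerivWithinAt.const_add _).congr_of_eventuallyEq heq
    (heq.self_of_nhdsWithin ht)).hasDerivWithinAt.derivWithin (uniqueDiffOn_Icc zero_lt_one t ht)

theorem pathIntegral_eq_integral_potential {a b : M} {γ : Path a b} (hγ : IsSmoothPath n γ) :
    η.pathIntegral γ = η.potential.integral γ := by
  obtain ⟨F, hF⟩ := η.potential.exists_isPrimitive (γ : C(I, M))
  calc η.pathIntegral γ
      = ∫ t in (0 : ℝ)..1, derivWithin (IccExtend (zero_le_one' ℝ) F) (Icc 0 1) t :=
        intervalIntegral.integral_congr fun t ht =>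
          (derivWithin_IccExtend_of_isPrimitive hγ hF (uIcc_of_le (zero_le_one' ℝ) ▸ ht)).symm
    _ = IccExtend (zero_le_one' ℝ) F 1 - IccExtend (zero_le_one' ℝ) F 0 :=
        intervalIntegral.integral_derivWithin_Icc_of_contDiffOn_Icc
          (contDiffOn_IccExtend_of_isPrimitive hγ hF) zero_le_one
    _ = F 1 - F 0 := congrArg₂ (· - ·) (IccExtend_right _ F) (IccExtend_left _ F)
    _ = η.potential.integral γ := hF.integral_eq.symm

end ClosedOneForm

variable {b : ℕ} {η : Fin b → ClosedOneForm n M} {Γ : Module.Basis (Fin b) ℤ (H1 M)}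

theorem IsDualTo.period_potential (h : IsDualTo η Γ) (i j : Fin b) :
    (η i).potential.period (Γ j) = if i = j then 1 else 0 := by
  have hj : ∃ l : (a : M) × Path a a, IsSmoothPath n l.2 ∧
      loopClass (l.2 : C(I, M)) (by simp) = Γ j := by
    by_contra hne
    have hjj := h j j
    rw [ClosedOneForm.period, dif_neg hne, if_pos rfl] at hjj
    exact zero_ne_one hjj
  obtain ⟨hsmooth, hclass⟩ := hj.choose_spec
  rw [← h i j, ClosedOneForm.period, dif_pos hj,
    ClosedOneForm.pathIntegral_eq_integral_potential hsmooth,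
    ← LocalPotential.period_loopClass _ _ (by simp), hclass]

theorem IsDualTo.period_potential_sum (h : IsDualTo η Γ) (i : Fin b) (v : Fin b → ℤ) :
    (η i).potential.period (∑ j, v j • Γ j) = v i := by
  simp [h.period_potential]

end Forms

/-! ### Smooth paths in a covering of a manifold -/

theorem exists_concat_curve {X : Type*} {g g' : ℝ → X} {y : X} (hg : ∀ t ≥ 1, g t = y)
    (hg' : ∀ t ≤ 0, g' t = y) : ∃ k : ℝ → X,
      (∀ t < 2 / 3, k t = g (3 * t)) ∧ ∀ t > 1 / 3, k t = g' (3 * t - 2) := by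
  refine ⟨fun t => if t ≤ 1 / 2 then g (3 * t) else g' (3 * t - 2), fun t ht => ?_, fun t ht => ?_⟩
  · refine ite_eq_left_iff.2 fun h => ?_
    rw [hg' _ (by linarith), hg _ (by linarith)]
  · refine ite_eq_right_iff.2 fun h => ?_
    rw [hg' _ (by linarith), hg _ (by linarith)]

section SmoothPaths

variable {n : ℕ} {M : Type u} [TopologicalSpace M] [ChartedSpace (EuclideanSpace ℝ (Fin n)) M]
  {Mt : Type v} [TopologicalSpace Mt]

variable (n) in
/-- `x` and `y` are joined by a curve whose projection is smooth. The curve is constant outside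
`[0, 1]`, so that concatenations of such curves have again a smooth projection. -/
def SmoothlyJoined (p : C(Mt, M)) (x y : Mt) : Prop :=
  ∃ g : ℝ → Mt, Continuous g ∧ ContMDiff 𝓘(ℝ, ℝ) (𝓡 n) ∞ (p ∘ g) ∧
    (∀ t ≤ 0, g t = x) ∧ ∀ t ≥ 1, g t = y

variable {p : C(Mt, M)} {x y z : Mt}

theorem SmoothlyJoined.symm (h : SmoothlyJoined n p x y) : SmoothlyJoined n p y x := by
  obtain ⟨g, hcont, hsmooth, hx, hy⟩ := h
  exact ⟨fun t => g (1 - t), by fun_prop,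
    hsmooth.comp (contMDiff_iff_contDiff.2 (contDiff_const.sub contDiff_id)),
    fun t ht => hy _ (by linarith), fun t ht => hx _ (by linarith)⟩

theorem SmoothlyJoined.trans (h : SmoothlyJoined n p x y) (h' : SmoothlyJoined n p y z) :
    SmoothlyJoined n p x z := by
  obtain ⟨g, hcont, hsmooth, hx, hy⟩ := h
  obtain ⟨g', hcont', hsmooth', hy', hz⟩ := h'
  obtain ⟨k, hk, hk'⟩ := exists_concat_curve hy hy'
  have hev (t : ℝ) : k =ᶠ[𝓝 t] (fun s => g (3 * s)) ∨ k =ᶠ[𝓝 t] fun s => g' (3 * s - 2) := by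
    rcases lt_or_ge t (2 / 3) with ht | ht
    · exact .inl (eventually_of_mem (Iio_mem_nhds ht) hk)
    · exact .inr (eventually_of_mem (Ioi_mem_nhds (by linarith)) hk')
  have hleft : ContMDiff 𝓘(ℝ, ℝ) (𝓡 n) ∞ fun t => p (g (3 * t)) :=
    hsmooth.comp (contMDiff_iff_contDiff.2 (contDiff_const.mul contDiff_id))
  have hright : ContMDiff 𝓘(ℝ, ℝ) (𝓡 n) ∞ fun t => p (g' (3 * t - 2)) :=
    hsmooth'.comp (contMDiff_iff_contDiff.2 ((contDiff_const.mul contDiff_id).sub contDiff_const))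
  refine ⟨k, continuous_iff_continuousAt.2 fun t => ?_, fun t => ?_, fun t ht => ?_,
    fun t ht => ?_⟩
  · exact (hev t).elim
      (fun h => (show Continuous fun s => g (3 * s) by fun_prop).continuousAt.congr h.symm)
      fun h => (show Continuous fun s => g' (3 * s - 2) by fun_prop).continuousAt.congr h.symm
  · exact (hev t).elim (fun h => (hleft t).congr_of_eventuallyEq (h.fun_comp p))
      fun h => (hright t).congr_of_eventuallyEq (h.fun_comp p)
  · rw [hk t (by linarith), hx _ (by linarith)]
  · rw [hk' t (by linarith), hz _ (by linarith)]

variable [IsManifold (𝓡 n) ∞ M]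

theorem eventually_smoothlyJoined (hp : IsLocalHomeomorph p) (x : Mt) :
    ∀ᶠ y in 𝓝 x, SmoothlyJoined n p x y := by
  obtain ⟨e, hx, he⟩ := hp x
  have htarget : e.target ∈ 𝓝 (p x) := by
    rw [he]
    exact e.open_target.mem_nhds (e.map_source hx)
  filter_upwards [e.open_source.mem_nhds hx, p.continuous.continuousAt.eventually
    (eventually_exists_contMDiff_curve (J := 𝓡 n) htarget)] with y hy ⟨c, hc, hce, hcx, hcy⟩
  have hlift : p ∘ (e.symm ∘ c) = c := by
    funext t
    exact (congrFun he _).trans (e.right_inv (hce t))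
  refine ⟨e.symm ∘ c, continuous_iff_continuousAt.2 fun t =>
    (e.continuousAt_symm (hce t)).comp hc.continuous.continuousAt, by rwa [hlift],
    fun t ht => ?_, fun t ht => ?_⟩
  · rw [Function.comp_apply, hcx t ht, he, e.left_inv hx]
  · rw [Function.comp_apply, hcy t ht, he, e.left_inv hy]

theorem exists_isSmoothPath [PreconnectedSpace Mt] (hp : IsLocalHomeomorph p) (x y : Mt) :
    ∃ γ : Path x y, IsSmoothPath n (γ.map p.continuous) := by
  have hclopen : IsClopen {z | SmoothlyJoined n p x z} := by
    refine ⟨⟨isOpen_iff_mem_nhds.2 fun z hz => ?_⟩, isOpen_iff_mem_nhds.2 fun z hz => ?_⟩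
    · filter_upwards [eventually_smoothlyJoined (n := n) hp z] with w hw h
      exact hz (h.trans hw.symm)
    · filter_upwards [eventually_smoothlyJoined (n := n) hp z] with w hw
      exact SmoothlyJoined.trans hz hw
  have hrefl : SmoothlyJoined n p x x :=
    ⟨fun _ => x, continuous_const, contMDiff_const, fun _ _ => rfl, fun _ _ => rfl⟩
  obtain ⟨g, hcont, hsmooth, hx, hy⟩ : SmoothlyJoined n p x y :=
    (hclopen.eq_univ ⟨x, hrefl⟩).symm.subset (mem_univ y)
  refine ⟨⟨⟨fun t => g t, by fun_prop⟩, hx _ le_rfl, hy _ le_rfl⟩, ?_⟩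
  refine hsmooth.contMDiffOn.congr fun t ht => ?_
  rw [Path.extend_apply _ ht]
  rfl

end SmoothPaths

/-! ### The Abel–Jacobi map -/

theorem locallyPathConnectedSpace_of_isLocalHomeomorph {X Y : Type*} [TopologicalSpace X]
    [TopologicalSpace Y] [LocallyPathConnectedSpace X] {p : Y → X} (hp : IsLocalHomeomorph p) :
    LocallyPathConnectedSpace Y :=
  letI : ChartedSpace X Y :=
    { atlas := range fun y => (hp y).choose
      chartAt := fun y => (hp y).choose
      mem_chart_source := fun y => (hp y).choose_spec.1
      chart_mem_atlas := mem_range_self }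
  ChartedSpace.locallyPathConnectedSpace X Y

section AbelJacobi

variable {n b : ℕ} {M : Type u} [TopologicalSpace M] [ChartedSpace (EuclideanSpace ℝ (Fin n)) M]
  [IsManifold (𝓡 n) ∞ M] {Mt : Type v} [TopologicalSpace Mt] [PathConnectedSpace Mt] {p : C(Mt, M)}
  {x₀ : Mt}

theorem abelJacobi_eq_integral_potential (hp : IsLocalHomeomorph p)
    (hrange : (FundamentalGroup.map p x₀).range ≤ commutator (FundamentalGroup M (p x₀)))
    (η : Fin b → ClosedOneForm n M) {x : Mt} (γ : Path x₀ x) (i : Fin b) :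
    abelJacobi p η x₀ x i = (η i).potential.integral (γ.map p.continuous) := by
  have h := exists_isSmoothPath (n := n) hp x₀ x
  rw [abelJacobi, dif_pos h, ClosedOneForm.pathIntegral_eq_integral_potential h.choose_spec]
  exact (η i).potential.integral_map_eq_of_range_le hrange _ _

theorem abelJacobi_sub (hp : IsLocalHomeomorph p)
    (hrange : (FundamentalGroup.map p x₀).range ≤ commutator (FundamentalGroup M (p x₀)))
    (η : Fin b → ClosedOneForm n M) {x y : Mt} (γ : Path x y) (i : Fin b) :
    abelJacobi p η x₀ y i - abelJacobi p η x₀ x i =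
      (η i).potential.integral (γ.map p.continuous) := by
  let γ₀ := PathConnectedSpace.somePath x₀ x
  rw [abelJacobi_eq_integral_potential hp hrange η γ₀,
    abelJacobi_eq_integral_potential hp hrange η (γ₀.trans γ), Path.map_trans,
    LocalPotential.integral_trans, add_sub_cancel_left]

theorem continuous_abelJacobi (hp : IsLocalHomeomorph p)
    (hrange : (FundamentalGroup.map p x₀).range ≤ commutator (FundamentalGroup M (p x₀)))
    (η : Fin b → ClosedOneForm n M) : Continuous (abelJacobi p η x₀) := by
  have := ChartedSpace.locallyPathConnectedSpace (EuclideanSpace ℝ (Fin n)) M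
  have := locallyPathConnectedSpace_of_isLocalHomeomorph hp
  refine continuous_pi fun i => ?_
  have hprim : (η i).potential.IsPrimitive p fun x => abelJacobi p η x₀ x i :=
    (η i).potential.isPrimitive_of_forall_integral_map_eq
      fun y z γ => (abelJacobi_sub hp hrange η γ i).symm
  exact hprim.continuous p.continuous fun x =>
    (ClosedOneForm.contMDiffAt_potential ((η i).potential.mem_baseSet x)).continuousAt

end AbelJacobi

/-! ### Translates in the cover -/

section Translates

variable {b : ℕ} {M : Type u} [TopologicalSpace M] {Mt : Type v} [TopologicalSpace Mt]

/-- `y` is the end point of a path starting at `x` which projects to a loop of homology class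
`∑ v_j Γ_j`: the relation of which `deck Γ p v` chooses a value `y` at each `x`. -/
def IsTranslate (Γ : Module.Basis (Fin b) ℤ (H1 M)) (p : C(Mt, M)) (v : Fin b → ℤ) (x y : Mt) :
    Prop :=
  ∃ (γ : Path x y) (hy : p x = p y),
    loopClass ((γ.map p.continuous : Path (p x) (p y)) : C(I, M)) (by simp [hy]) = ∑ j, v j • Γ j

variable {Γ : Module.Basis (Fin b) ℤ (H1 M)} {p : C(Mt, M)} {v : Fin b → ℤ} {x y : Mt}

theorem sum_zsmul_basis (Γ : Module.Basis (Fin b) ℤ (H1 M)) (v : Fin b → ℤ) :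
    ∑ j, v j • Γ j = Γ.equivFun.symm v := by
  rw [Module.Basis.equivFun_symm_apply]
  exact Finset.sum_congr rfl fun j _ => (int_smul_eq_zsmul _ (v j) (Γ j)).symm

theorem exists_isTranslate [PathConnectedSpace Mt] (h : p x = p y) :
    ∃ v, IsTranslate Γ p v x y :=
  ⟨_, PathConnectedSpace.somePath x y, h,
    ((sum_zsmul_basis Γ _).trans (Γ.equivFun.symm_apply_apply _)).symm⟩

theorem isTranslate_zero (x : Mt) : IsTranslate Γ p 0 x x := by
  refine ⟨Path.refl x, rfl, ?_⟩
  rw [sum_zsmul_basis, map_zero]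
  exact loopClass_const (p x)

theorem equivFun_symm_homologyMatrix_mulVec (Γ : Module.Basis (Fin b) ℤ (H1 M)) (f : C(M, M))
    (v : Fin b → ℤ) :
    Γ.equivFun.symm ((homologyMatrix Γ f).mulVec v) = H1map f (Γ.equivFun.symm v) := by
  have h := LinearMap.toMatrix_mulVec_repr Γ Γ (H1map f) (Γ.equivFun.symm v)
  rw [← Module.Basis.equivFun_apply, ← Module.Basis.equivFun_apply,
    LinearEquiv.apply_symm_apply] at h
  rw [homologyMatrix, h, LinearEquiv.symm_apply_apply]

theorem IsTranslate.map {f : C(M, M)} {ft : C(Mt, Mt)} (hft : ∀ x, p (ft x) = f (p x))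
    (h : IsTranslate Γ p v x y) :
    IsTranslate Γ p ((homologyMatrix Γ f).mulVec v) (ft x) (ft y) := by
  obtain ⟨γ, hy, hγ⟩ := h
  refine ⟨γ.map ft.continuous, by rw [hft, hft, hy], ?_⟩
  have hproj : (((γ.map ft.continuous).map p.continuous : Path (p (ft x)) (p (ft y))) : C(I, M)) =
      f.comp (γ.map p.continuous : Path (p x) (p y)) :=
    ContinuousMap.ext fun t => hft (γ t)
  simp only [hproj]
  rw [← H1map_loopClass _ _ (by simp [hy]), hγ, sum_zsmul_basis, sum_zsmul_basis,
    equivFun_symm_homologyMatrix_mulVec]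

theorem IsTranslate.iterate {f : C(M, M)} {ft : C(Mt, Mt)} (hft : ∀ x, p (ft x) = f (p x))
    (h : IsTranslate Γ p v x y) (k : ℕ) :
    IsTranslate Γ p ((homologyMatrix Γ f ^ k).mulVec v) (ft^[k] x) (ft^[k] y) := by
  induction k with
  | zero => simpa using h
  | succ k ih =>
    rw [Function.iterate_succ_apply', Function.iterate_succ_apply', pow_succ',
      ← Matrix.mulVec_mulVec]
    exact ih.map hft

theorem IsTranslate.exists_neg (hp : IsCoveringMap p) (h : IsTranslate Γ p v x y) :
    ∃ z, IsTranslate Γ p (-v) x z := by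
  obtain ⟨γ, hy, hγ⟩ := h
  let loop : Path (p x) (p x) := (γ.map p.continuous).cast rfl hy
  let lift := hp.liftPath loop.symm x (by simp)
  have hlift : p ∘ lift = loop.symm := hp.liftPath_lifts _ _ _
  have hlift₀ : lift 0 = x := hp.liftPath_zero _ _ _
  have hlift₁ : p (lift 1) = p x := (congrFun hlift 1).trans loop.symm.target
  refine ⟨lift 1, ⟨lift, hlift₀, rfl⟩, hlift₁.symm, ?_⟩
  have hproj : ((Path.map (⟨lift, hlift₀, rfl⟩ : Path x (lift 1)) p.continuous :
      Path (p x) (p (lift 1))) : C(I, M)) = loop.symm :=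
    ContinuousMap.ext (congrFun hlift)
  simp only [hproj]
  rw [loopClass_symm, sum_zsmul_basis, map_neg, ← sum_zsmul_basis, ← hγ]
  rfl

theorem isTranslate_deck (h : ∃ y, IsTranslate Γ p v x y) :
    IsTranslate Γ p v x (deck Γ p v x) := by
  unfold deck
  exact (dif_pos h).symm ▸ h.choose_spec

theorem deck_eq_self (h : ¬∃ y, IsTranslate Γ p v x y) : deck Γ p v x = x :=
  dif_neg h

namespace IsFundamentalDomain

variable {M₀ : Set Mt}

theorem isTranslate_deck (hM : IsFundamentalDomain Γ p M₀) (hp : IsCoveringMap p) (hx : x ∈ M₀) :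
    IsTranslate Γ p v x (deck Γ p v x) := by
  -- Without a translate of `x` by `v` there is none by `-v` either; then `deck` has its default
  -- value `x` at both, and the tiles of `v` and `-v` meet in `x`.
  refine AbelianCover.isTranslate_deck ?_
  by_contra hv
  have hnegv : ¬∃ y, IsTranslate Γ p (-v) x y := fun ⟨_, hy⟩ => hv <| by
    simpa only [neg_neg] using hy.exists_neg hp
  have hne : v ≠ -v := fun h => hv ⟨x, (self_eq_neg.1 h) ▸ isTranslate_zero x⟩
  exact disjoint_left.1 (hM.pairwise_disjoint hne) ⟨x, hx, deck_eq_self hv⟩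
    ⟨x, hx, deck_eq_self hnegv⟩

theorem mem_deck_tileIndex (hM : IsFundamentalDomain Γ p M₀) (x : Mt) :
    x ∈ deck Γ p (tileIndex Γ p M₀ x) '' M₀ := by
  have h : ∃ v : Fin b → ℤ, x ∈ deck Γ p v '' M₀ := mem_iUnion.1 (hM.iUnion_eq.symm ▸ mem_univ x)
  rw [tileIndex, dif_pos h]
  exact h.choose_spec

end IsFundamentalDomain

end Translates

/-! ### Equivariant maps -/

section Equivariant

variable {b : ℕ} {M : Type u} [TopologicalSpace M] {Mt : Type v} [TopologicalSpace Mt]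
  {Γ : Module.Basis (Fin b) ℤ (H1 M)} {p : C(Mt, M)} {F F' : Mt → Fin b → ℝ}

variable (Γ p) in
/-- A continuous map to `ℝ^b` which intertwines deck transformations with integer translations,
such as `ι̃` and `β̃`. The intertwining is stated for the relation `IsTranslate`, so that no
choice of a value of `deck` is involved. -/
structure IsEquivariant (F : Mt → Fin b → ℝ) : Prop where
  continuous : Continuous F
  map_translate : ∀ {v : Fin b → ℤ} {x y : Mt}, IsTranslate Γ p v x y →
    F y = F x + fun i => (v i : ℝ)

theorem isEquivariant_abelJacobi {n : ℕ} [ChartedSpace (EuclideanSpace ℝ (Fin n)) M]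
    [IsManifold (𝓡 n) ∞ M] [PathConnectedSpace Mt] (hp : IsLocalHomeomorph p) {x₀ : Mt}
    (hrange : (FundamentalGroup.map p x₀).range ≤ commutator (FundamentalGroup M (p x₀)))
    {η : Fin b → ClosedOneForm n M} (hη : IsDualTo η Γ) :
    IsEquivariant Γ p (abelJacobi p η x₀) where
  continuous := continuous_abelJacobi hp hrange η
  map_translate := by
    rintro v x y ⟨γ, hy, hγ⟩
    funext i
    rw [Pi.add_apply, ← sub_eq_iff_eq_add', abelJacobi_sub hp hrange η γ i,
      ← LocalPotential.period_loopClass _ _ (by simp [hy]), hγ, hη.period_potential_sum]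

theorem IsEquivariant.exists_norm_sub_tileIndex_le (hF : IsEquivariant Γ p F)
    (hp : IsCoveringMap p) {M₀ : Set Mt} (hM : IsFundamentalDomain Γ p M₀) :
    ∃ C, ∀ x, ‖F x - fun i => (tileIndex Γ p M₀ x i : ℝ)‖ ≤ C := by
  obtain ⟨C, hC⟩ := hM.isCompact_closure.exists_bound_of_continuousOn hF.continuous.continuousOn
  refine ⟨C, fun x => ?_⟩
  obtain ⟨y, hy, hyx⟩ := hM.mem_deck_tileIndex x
  have hxy := hF.map_translate (hM.isTranslate_deck (v := tileIndex Γ p M₀ x) hp hy)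
  rw [hyx] at hxy
  rw [hxy, add_sub_cancel_right]
  exact hC y (subset_closure hy)

theorem exists_norm_le_of_factorsThrough {X Y E : Type*} [TopologicalSpace X] [CompactSpace X]
    [TopologicalSpace Y] [SeminormedAddCommGroup E] {p : C(Y, X)} (hp : IsQuotientMap p)
    {g : Y → E} (hg : Continuous g) (h : Function.FactorsThrough g p) : ∃ C, ∀ x, ‖g x‖ ≤ C := by
  let G : C(X, E) := hp.lift ⟨g, hg⟩ h
  obtain ⟨C, hC⟩ := isCompact_univ.exists_bound_of_continuousOn G.continuous.continuousOn
  refine ⟨C, fun x => ?_⟩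
  have hG : G (p x) = g x := DFunLike.congr_fun (hp.lift_comp ⟨g, hg⟩ h) x
  exact hG ▸ hC (p x) (mem_univ _)

theorem IsEquivariant.exists_norm_sub_le [CompactSpace M] [PathConnectedSpace Mt]
    (hp : IsQuotientMap p) (hF : IsEquivariant Γ p F) (hF' : IsEquivariant Γ p F') :
    ∃ C, ∀ x, ‖F x - F' x‖ ≤ C := by
  refine exists_norm_le_of_factorsThrough hp (hF.continuous.sub hF'.continuous) fun x y hxy => ?_
  obtain ⟨v, hv⟩ := exists_isTranslate (Γ := Γ) hxy
  rw [hF.map_translate hv, hF'.map_translate hv, add_sub_add_right_eq_sub]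

theorem surjective_of_isCoveringMap {X Y : Type*} [TopologicalSpace X] [PathConnectedSpace X]
    [TopologicalSpace Y] [Nonempty Y] {p : Y → X} (hp : IsCoveringMap p) :
    Function.Surjective p := by
  intro y
  obtain ⟨x⟩ := ‹Nonempty Y›
  let γ := PathConnectedSpace.somePath (p x) y
  exact ⟨hp.liftPath γ x (by simp) 1,
    (congrFun (hp.liftPath_lifts γ x (by simp)) 1).trans γ.target⟩

end Equivariant

/-! ### Operators with summable powers -/

theorem spectralRadius_lt_of_forall_lt {A : Type*} [NormedRing A] [NormedAlgebra ℂ A]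
    [CompleteSpace A] {a : A} {r : NNReal} (hr : 0 < r) (h : ∀ z ∈ spectrum ℂ a, ‖z‖₊ < r) :
    spectralRadius ℂ a < r := by
  rcases (spectrum ℂ a).eq_empty_or_nonempty with hempty | hne
  · simpa [spectralRadius, hempty] using hr
  · exact spectrum.spectralRadius_lt_of_forall_lt_of_nonempty hne h

theorem summable_norm_pow_of_spectralRadius_lt_one {A : Type*} [NormedRing A] [NormedAlgebra ℂ A]
    [CompleteSpace A] {a : A} (ha : spectralRadius ℂ a < 1) : Summable fun k : ℕ => ‖a ^ k‖ := by
  obtain ⟨r, har, hr⟩ := ENNReal.lt_iff_exists_nnreal_btwn.1 ha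
  have hroot : ∀ᶠ k : ℕ in atTop, (‖a ^ k‖₊ : ENNReal) ^ (1 / k : ℝ) < r :=
    (spectrum.pow_nnnorm_pow_one_div_tendsto_nhds_spectralRadius a).eventually_lt_const har
  refine Summable.of_norm_bounded_eventually_nat (g := fun k => (r : ℝ) ^ k)
    (summable_geometric_of_lt_one r.2 (by exact_mod_cast hr)) ?_
  filter_upwards [hroot, eventually_gt_atTop 0] with k hk hk₀
  have hk₀' : (0 : ℝ) < k := Nat.cast_pos.2 hk₀
  rw [one_div, ENNReal.rpow_inv_lt_iff hk₀', ENNReal.rpow_natCast] at hk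
  rw [norm_norm]
  exact_mod_cast hk.le

section Operators

variable {𝕜 E : Type*} [NontriviallyNormedField 𝕜] [NormedAddCommGroup E] [NormedSpace 𝕜 E]

theorem tendsto_apply_zero_of_norm_le {ι : Type*} {l : Filter ι} {S : ι → E →L[𝕜] E}
    (hS : Tendsto S l (𝓝 0)) {c : ι → E} {C : ℝ} (hc : ∀ i, ‖c i‖ ≤ C) :
    Tendsto (fun i => S i (c i)) l (𝓝 0) := by
  refine squeeze_zero_norm (a := fun i => ‖S i‖ * C) (fun i => (S i).le_opNorm_of_le (hc i)) ?_
  simpa only [norm_zero, zero_mul] using hS.norm.mul_const C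

theorem tendsto_of_tendsto_sub_apply {ι : Type*} {l : Filter ι} {S : ι → E →L[𝕜] E}
    (hS : Tendsto S l (𝓝 0)) {q : ι → E} {y : E}
    (h : Tendsto (fun i => q i - S i (q i)) l (𝓝 y)) : Tendsto q l (𝓝 y) := by
  have hSq : (fun i => S i (q i)) =o[l] q := by
    rw [Asymptotics.isLittleO_iff]
    intro c hc
    filter_upwards [hS.norm.eventually_le_const (by rwa [norm_zero])] with i hi
    exact (S i).le_of_opNorm_le hi _
  have hzero : Tendsto (fun i => S i (q i)) l (𝓝 0) :=
    (Asymptotics.isLittleO_one_iff ℝ).1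
      (hSq.trans_isBigO (hSq.right_isBigO_sub.trans (h.isBigO_one ℝ)))
  simpa only [sub_add_cancel, add_zero] using h.add hzero

theorem tendsto_pow_zero_of_summable_norm {T : E →L[𝕜] E} (hT : Summable fun k : ℕ => ‖T ^ k‖) :
    Tendsto (fun k : ℕ => T ^ k) atTop (𝓝 0) :=
  tendsto_zero_iff_norm_tendsto_zero.2 hT.tendsto_atTop_zero

theorem pow_apply_iterate_eq_add_sum {X : Type*} (T : E →L[𝕜] E) (g : X → X) (F : X → E) (x : X)
    (k : ℕ) : (T ^ k) (F (g^[k] x)) =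
      F x + ∑ j ∈ Finset.range k, (T ^ j) (T (F (g (g^[j] x))) - F (g^[j] x)) := by
  induction k with
  | zero => simp
  | succ k ih =>
    rw [Finset.sum_range_succ, ← add_assoc, ← ih, map_sub, add_sub_cancel, pow_succ,
      mul_apply_eq_comp, Function.iterate_succ_apply']

theorem exists_continuous_tendsto_pow_apply_iterate [CompleteSpace E] {X : Type*}
    [TopologicalSpace X] {T : E →L[𝕜] E} (hT : Summable fun k : ℕ => ‖T ^ k‖) {g : X → X}
    (hg : Continuous g) {F : X → E} (hF : Continuous F) {C : ℝ}
    (hC : ∀ x, ‖T (F (g x)) - F x‖ ≤ C) :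
    ∃ β : X → E, Continuous β ∧
      ∀ x, Tendsto (fun k => (T ^ k) (F (g^[k] x))) atTop (𝓝 (β x)) := by
  have hterm (j : ℕ) (x : X) :
      ‖(T ^ j) (T (F (g (g^[j] x))) - F (g^[j] x))‖ ≤ ‖T ^ j‖ * C :=
    (T ^ j).le_opNorm_of_le (hC _)
  refine ⟨fun x => F x + ∑' j, (T ^ j) (T (F (g (g^[j] x))) - F (g^[j] x)), ?_, fun x => ?_⟩
  · exact hF.add <| continuous_tsum (fun j => by fun_prop) (hT.mul_right C) hterm
  · simp only [pow_apply_iterate_eq_add_sum]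
    exact (Summable.of_norm_bounded (hT.mul_right C)
      fun j => hterm j x).hasSum.tendsto_sum_nat.const_add _

theorem apply_eq_of_tendsto_pow_apply_iterate {X : Type*} {T : E →L[𝕜] E} {g : X → X} {F β : X → E}
    (h : ∀ x, Tendsto (fun k => (T ^ k) (F (g^[k] x))) atTop (𝓝 (β x))) (x : X) :
    T (β (g x)) = β x := by
  refine tendsto_nhds_unique ((T.continuous.tendsto _).comp (h (g x)))
    (((h x).comp (tendsto_add_atTop_nat 1)).congr fun k => ?_)
  simp only [Function.comp_apply, pow_succ', mul_apply_eq_comp, Function.iterate_succ_apply]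

end Operators

/-! ### Expanding integer matrices -/

/-- A real square matrix as a bounded operator for the sup norm. -/
def mulVecCLM {ι : Type*} [Fintype ι] [DecidableEq ι] :
    Matrix ι ι ℝ ≃ₐ[ℝ] ((ι → ℝ) →L[ℝ] (ι → ℝ)) :=
  Matrix.toLinAlgEquiv'.trans (Module.End.toContinuousLinearMap _)

theorem mulVecCLM_apply {ι : Type*} [Fintype ι] [DecidableEq ι] (B : Matrix ι ι ℝ) (w : ι → ℝ) :
    mulVecCLM B w = B.mulVec w :=
  rfl

theorem isUnit_map_intCast_iff {ι K : Type*} [Fintype ι] [DecidableEq ι] [Field K] [CharZero K]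
    (N : Matrix ι ι ℤ) : IsUnit (N.map (Int.cast : ℤ → K)) ↔ N.det ≠ 0 := by
  rw [Matrix.isUnit_iff_isUnit_det, isUnit_iff_ne_zero, ← Int.cast_ne_zero (α := K)]
  exact not_congr (Eq.congr_left ((Int.castRingHom K).map_det N).symm)

theorem isUnit_map_intCast_congr {ι K K' : Type*} [Fintype ι] [DecidableEq ι] [Field K]
    [CharZero K] [Field K'] [CharZero K'] (N : Matrix ι ι ℤ) :
    IsUnit (N.map (Int.cast : ℤ → K)) ↔ IsUnit (N.map (Int.cast : ℤ → K')) :=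
  (isUnit_map_intCast_iff N).trans (isUnit_map_intCast_iff N).symm

section Expanding

attribute [local instance] Matrix.linftyOpNormedRing Matrix.linftyOpNormedAlgebra

variable {b : ℕ} {A : Matrix (Fin b) (Fin b) ℤ}

theorem norm_mulVecCLM_eq_norm_map_ofReal {ι : Type*} [Fintype ι] [DecidableEq ι]
    (B : Matrix ι ι ℝ) : ‖mulVecCLM B‖ = ‖B.map (Complex.ofReal : ℝ → ℂ)‖ := by
  have hnorm : ‖B.map (Complex.ofReal : ℝ → ℂ)‖₊ = ‖B‖₊ := by
    simp [Matrix.linfty_opNNNorm_def]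
  exact (Matrix.linfty_opNorm_eq_opNorm B).symm.trans (congrArg NNReal.toReal hnorm).symm

theorem realMatrix_pow (A : Matrix (Fin b) (Fin b) ℤ) (k : ℕ) :
    realMatrix (A ^ k) = realMatrix A ^ k :=
  A.map_pow (Int.castRingHom ℝ) k

theorem realMatrix_mulVec_intCast (A : Matrix (Fin b) (Fin b) ℤ) (v : Fin b → ℤ) :
    (realMatrix A).mulVec (fun i => (v i : ℝ)) = fun i => (A.mulVec v i : ℝ) :=
  funext fun i => ((Int.castRingHom ℝ).map_mulVec A v i).symm

theorem inv_pow_mulVec_eq_pow_mulVecCLM_inv {ι : Type*} [Fintype ι] [DecidableEq ι]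
    (B : Matrix ι ι ℝ) (k : ℕ) (w : ι → ℝ) :
    (B ^ k)⁻¹.mulVec w = (mulVecCLM B⁻¹ ^ k) w := by
  rw [← map_pow, Matrix.inv_pow', mulVecCLM_apply]

namespace IsExpanding

theorem one_lt_norm_of_mem_spectrum (hA : IsExpanding A) {μ : ℂ}
    (hμ : μ ∈ spectrum ℂ (A.map (Int.cast : ℤ → ℂ))) : 1 < ‖μ‖ :=
  hA μ <| by rwa [Module.End.hasEigenvalue_iff_mem_spectrum, Matrix.spectrum_toLin']

theorem isUnit_realMatrix (hA : IsExpanding A) : IsUnit (realMatrix A) := by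
  rw [isUnit_map_intCast_congr (K' := ℂ), ← spectrum.zero_notMem_iff ℂ]
  exact fun h => (norm_zero (E := ℂ) ▸ hA.one_lt_norm_of_mem_spectrum h).not_ge zero_le_one

theorem isUnit_pow_sub_one (hA : IsExpanding A) {k : ℕ} (hk : 1 ≤ k) :
    IsUnit (realMatrix A ^ k - 1) := by
  have hspec : (1 : ℂ) ∉ spectrum ℂ (A.map (Int.cast : ℤ → ℂ) ^ k) := by
    rw [spectrum.map_pow_of_pos _ hk]
    rintro ⟨μ, hμ, hpow⟩
    have hlt := one_lt_pow₀ (hA.one_lt_norm_of_mem_spectrum hμ) (Nat.one_le_iff_ne_zero.1 hk)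
    rw [← norm_pow, show μ ^ k = 1 from hpow, norm_one] at hlt
    exact hlt.false
  have hcast (K : Type) [Field K] :
      (A ^ k - 1).map (Int.cast : ℤ → K) = A.map Int.cast ^ k - 1 := by
    let φ := (Int.castRingHom K).mapMatrix (m := Fin b)
    exact (map_sub φ _ _).trans (by rw [map_pow, map_one]; rfl)
  rw [spectrum.notMem_iff, map_one, ← neg_sub, IsUnit.neg_iff] at hspec
  rwa [← hcast, isUnit_map_intCast_congr (K' := ℂ), hcast]

theorem summable_norm_pow_mulVecCLM_inv (hA : IsExpanding A) :
    Summable fun k : ℕ => ‖mulVecCLM (realMatrix A)⁻¹ ^ k‖ := by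
  let φ : Matrix (Fin b) (Fin b) ℝ →+* Matrix (Fin b) (Fin b) ℂ := Complex.ofRealHom.mapMatrix
  let B := hA.isUnit_realMatrix.unit
  let Bℂ := Units.map φ.toMonoidHom B
  have hB : (Bℂ : Matrix (Fin b) (Fin b) ℂ) = A.map Int.cast := by
    ext i j
    exact Complex.ofReal_intCast _
  have hspec (μ : ℂ) (hμ : μ ∈ spectrum ℂ (↑Bℂ⁻¹ : Matrix (Fin b) (Fin b) ℂ)) : ‖μ‖₊ < 1 := by
    have hlt := hA.one_lt_norm_of_mem_spectrum (hB ▸ spectrum.inv₀_mem_iff.2 hμ)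
    rw [norm_inv] at hlt
    exact (one_lt_inv₀ (inv_pos.1 (zero_lt_one.trans hlt))).1 hlt
  refine (summable_norm_pow_of_spectralRadius_lt_one
    (spectralRadius_lt_of_forall_lt one_pos hspec)).congr fun k => ?_
  have hinv : (↑Bℂ⁻¹ : Matrix (Fin b) (Fin b) ℂ) = φ (realMatrix A)⁻¹ :=
    congrArg φ (Matrix.coe_units_inv B)
  rw [hinv, ← map_pow, ← map_pow, norm_mulVecCLM_eq_norm_map_ofReal]
  rfl

theorem tendsto_pow_mulVecCLM_inv (hA : IsExpanding A) :
    Tendsto (fun k : ℕ => mulVecCLM (realMatrix A)⁻¹ ^ k) atTop (𝓝 0) :=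
  tendsto_pow_zero_of_summable_norm hA.summable_norm_pow_mulVecCLM_inv

theorem pow_mulVecCLM_inv_apply_pow_mulVec (hA : IsExpanding A) (k : ℕ) (w : Fin b → ℝ) :
    (mulVecCLM (realMatrix A)⁻¹ ^ k) ((realMatrix A ^ k).mulVec w) = w := by
  have hdet := (Matrix.isUnit_iff_isUnit_det _).1 (hA.isUnit_realMatrix.pow k)
  rw [← inv_pow_mulVec_eq_pow_mulVecCLM_inv, Matrix.mulVec_mulVec, Matrix.nonsing_inv_mul _ hdet,
    Matrix.one_mulVec]

theorem tendsto_inv_pow_sub_one_mulVec (hA : IsExpanding A) {d : ℕ → Fin b → ℝ} {y : Fin b → ℝ}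
    (h : Tendsto (fun k => (mulVecCLM (realMatrix A)⁻¹ ^ k) (d k)) atTop (𝓝 y)) :
    Tendsto (fun k => (realMatrix A ^ k - 1)⁻¹.mulVec (d k)) atTop (𝓝 y) := by
  -- `q = (A^k - 1)⁻¹ d` solves `q - A^{-k} q = A^{-k} d`, and `A^{-k} → 0`.
  refine tendsto_of_tendsto_sub_apply hA.tendsto_pow_mulVecCLM_inv (h.congr' ?_)
  filter_upwards [eventually_ge_atTop 1] with k hk
  set q := (realMatrix A ^ k - 1)⁻¹.mulVec (d k) with hq
  have hdet := (Matrix.isUnit_iff_isUnit_det _).1 (hA.isUnit_pow_sub_one hk)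
  have hd : (realMatrix A ^ k - 1).mulVec q = d k := by
    rw [hq, Matrix.mulVec_mulVec, Matrix.mul_nonsing_inv _ hdet, Matrix.one_mulVec]
  rw [← hd, Matrix.sub_mulVec, Matrix.one_mulVec, map_sub, hA.pow_mulVecCLM_inv_apply_pow_mulVec]

end IsExpanding

end Expanding

/-! ### The limit of an equivariant map -/

namespace IsEquivariant

variable {b : ℕ} {M : Type u} [TopologicalSpace M] {Mt : Type v} [TopologicalSpace Mt]
  {Γ : Module.Basis (Fin b) ℤ (H1 M)} {p : C(Mt, M)} {f : C(M, M)} {ft : C(Mt, Mt)}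
  {F F' β β' : Mt → Fin b → ℝ}

theorem map_iterate_translate (hF : IsEquivariant Γ p F) (hft : ∀ x, p (ft x) = f (p x))
    {v : Fin b → ℤ} {x y : Mt} (h : IsTranslate Γ p v x y) (k : ℕ) :
    F (ft^[k] y) = F (ft^[k] x) +
      (realMatrix (homologyMatrix Γ f) ^ k).mulVec fun i => (v i : ℝ) := by
  rw [hF.map_translate (h.iterate hft k), ← realMatrix_pow, realMatrix_mulVec_intCast]

theorem pow_mulVecCLM_inv_map_iterate_translate (hF : IsEquivariant Γ p F)
    (hft : ∀ x, p (ft x) = f (p x)) (hA : IsExpanding (homologyMatrix Γ f)) {v : Fin b → ℤ}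
    {x y : Mt} (h : IsTranslate Γ p v x y) (k : ℕ) :
    (mulVecCLM (realMatrix (homologyMatrix Γ f))⁻¹ ^ k) (F (ft^[k] y)) =
      (mulVecCLM (realMatrix (homologyMatrix Γ f))⁻¹ ^ k) (F (ft^[k] x)) +
        fun i => (v i : ℝ) := by
  rw [hF.map_iterate_translate hft h, map_add, hA.pow_mulVecCLM_inv_apply_pow_mulVec]

theorem of_tendsto (hF : IsEquivariant Γ p F) (hft : ∀ x, p (ft x) = f (p x))
    (hA : IsExpanding (homologyMatrix Γ f)) (hβ : Continuous β)
    (hlim : ∀ x, Tendsto (fun k => (mulVecCLM (realMatrix (homologyMatrix Γ f))⁻¹ ^ k)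
      (F (ft^[k] x))) atTop (𝓝 (β x))) : IsEquivariant Γ p β where
  continuous := hβ
  map_translate {_ x y} h := tendsto_nhds_unique (hlim y) <|
    ((hlim x).add_const _).congr fun k =>
      (hF.pow_mulVecCLM_inv_map_iterate_translate hft hA h k).symm

section Compact

variable [CompactSpace M] [PathConnectedSpace Mt]

theorem exists_norm_mulVecCLM_inv_sub_le (hp : IsQuotientMap p) (hF : IsEquivariant Γ p F)
    (hft : ∀ x, p (ft x) = f (p x)) (hA : IsExpanding (homologyMatrix Γ f)) :
    ∃ C, ∀ x, ‖mulVecCLM (realMatrix (homologyMatrix Γ f))⁻¹ (F (ft x)) - F x‖ ≤ C := by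
  have hcont := hF.continuous
  refine exists_norm_le_of_factorsThrough hp (by fun_prop) fun x y hxy => ?_
  obtain ⟨v, hv⟩ := exists_isTranslate (Γ := Γ) hxy
  have htranslate := hF.pow_mulVecCLM_inv_map_iterate_translate hft hA hv 1
  simp only [pow_one, Function.iterate_one] at htranslate
  rw [htranslate, hF.map_translate hv, add_sub_add_right_eq_sub]

theorem exists_tendsto (hp : IsQuotientMap p) (hF : IsEquivariant Γ p F)
    (hft : ∀ x, p (ft x) = f (p x)) (hA : IsExpanding (homologyMatrix Γ f)) :
    ∃ β, IsEquivariant Γ p β ∧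
      ∀ x, Tendsto (fun k => (mulVecCLM (realMatrix (homologyMatrix Γ f))⁻¹ ^ k)
        (F (ft^[k] x))) atTop (𝓝 (β x)) := by
  obtain ⟨C, hC⟩ := hF.exists_norm_mulVecCLM_inv_sub_le hp hft hA
  obtain ⟨β, hβ, hlim⟩ := exists_continuous_tendsto_pow_apply_iterate
    hA.summable_norm_pow_mulVecCLM_inv ft.continuous hF.continuous hC
  exact ⟨β, hF.of_tendsto hft hA hβ hlim, hlim⟩

theorem eq_of_tendsto (hp : IsQuotientMap p) (hF : IsEquivariant Γ p F)
    (hF' : IsEquivariant Γ p F') {A : Matrix (Fin b) (Fin b) ℤ} (hA : IsExpanding A)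
    (hlim : ∀ x, Tendsto (fun k => (mulVecCLM (realMatrix A)⁻¹ ^ k) (F (ft^[k] x))) atTop
      (𝓝 (β x)))
    (hlim' : ∀ x, Tendsto (fun k => (mulVecCLM (realMatrix A)⁻¹ ^ k) (F' (ft^[k] x))) atTop
      (𝓝 (β' x))) : β = β' := by
  funext x
  obtain ⟨C, hC⟩ := hF.exists_norm_sub_le hp hF'
  refine sub_eq_zero.1 (tendsto_nhds_unique ((hlim x).sub (hlim' x)) ?_)
  simpa only [map_sub] using
    tendsto_apply_zero_of_norm_le hA.tendsto_pow_mulVecCLM_inv fun k => hC (ft^[k] x)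

end Compact

theorem tendsto_pow_mulVecCLM_inv_displacement (hF : IsEquivariant Γ p F) (hp : IsCoveringMap p)
    {A : Matrix (Fin b) (Fin b) ℤ} (hA : IsExpanding A) {x : Mt} {y : Fin b → ℝ}
    (hlim : Tendsto (fun k => (mulVecCLM (realMatrix A)⁻¹ ^ k) (F (ft^[k] x))) atTop (𝓝 y))
    {M₀ : Set Mt} (hM : IsFundamentalDomain Γ p M₀) :
    Tendsto (fun k => (mulVecCLM (realMatrix A)⁻¹ ^ k)
      fun i => (displacement Γ p M₀ ft k x i : ℝ)) atTop (𝓝 y) := by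
  obtain ⟨C, hC⟩ := hF.exists_norm_sub_tileIndex_le hp hM
  have hbdd (k : ℕ) : ‖F (ft^[k] x) - fun i => (displacement Γ p M₀ ft k x i : ℝ)‖ ≤
      C + ‖fun i => (tileIndex Γ p M₀ x i : ℝ)‖ := by
    have hsplit : (F (ft^[k] x) - fun i => (displacement Γ p M₀ ft k x i : ℝ)) =
        (F (ft^[k] x) - fun i => (tileIndex Γ p M₀ (ft^[k] x) i : ℝ)) +
          fun i => (tileIndex Γ p M₀ x i : ℝ) := by
      funext i
      simp only [displacement, Pi.sub_apply, Pi.add_apply, Int.cast_sub]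
      ring
    exact hsplit ▸ (norm_add_le _ _).trans (add_le_add_left (hC _) _)
  have hdiff := hlim.sub (tendsto_apply_zero_of_norm_le hA.tendsto_pow_mulVecCLM_inv hbdd)
  simpa only [map_sub, sub_sub_cancel, sub_zero] using hdiff

end IsEquivariant

/-! ### The torus -/

theorem toTorus_add_intCast {b : ℕ} (w : Fin b → ℝ) (v : Fin b → ℤ) :
    toTorus (w + fun i => (v i : ℝ)) = toTorus w := by
  funext i
  simp [toTorus]

theorem continuous_toTorus {b : ℕ} : Continuous (toTorus (b := b)) :=
  continuous_pi fun i => (AddCircle.continuous_mk' 1).comp (continuous_apply i)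

theorem toTorus_mulVec {b : ℕ} (A : Matrix (Fin b) (Fin b) ℤ) (w : Fin b → ℝ) :
    toTorus ((realMatrix A).mulVec w) = toralEndo A (toTorus w) := by
  funext i
  simp only [toTorus, toralEndo, Matrix.mulVec, dotProduct, Matrix.map_apply, ← zsmul_eq_mul]
  exact map_sum (QuotientAddGroup.mk' _) _ _

/-! ### The semiconjugacy -/

section Beta

variable {n b : ℕ} {M : Type u} [TopologicalSpace M] [ChartedSpace (EuclideanSpace ℝ (Fin n)) M]
  {Mt : Type v} [TopologicalSpace Mt] [PathConnectedSpace Mt] {Γ : Module.Basis (Fin b) ℤ (H1 M)}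
  {p : C(Mt, M)} {f : C(M, M)} {ft : C(Mt, Mt)} {η η' : Fin b → ClosedOneForm n M} {x₀ x₀' : Mt}

theorem beta_apply {A : Matrix (Fin b) (Fin b) ℤ}
    (hβ : IsEquivariant Γ p (betaLift A p η x₀ ft)) (x : Mt) :
    beta A p η x₀ ft (p x) = toTorus (betaLift A p η x₀ ft x) := by
  have hx : ∃ y, p y = p x := ⟨x, rfl⟩
  obtain ⟨v, hv⟩ := exists_isTranslate (Γ := Γ) hx.choose_spec
  rw [beta, dif_pos hx, hβ.map_translate hv, toTorus_add_intCast]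

theorem continuous_beta {A : Matrix (Fin b) (Fin b) ℤ}
    (hβ : IsEquivariant Γ p (betaLift A p η x₀ ft)) (hp : IsQuotientMap p) :
    Continuous (beta A p η x₀ ft) := by
  rw [hp.continuous_iff, show beta A p η x₀ ft ∘ p = toTorus ∘ betaLift A p η x₀ ft from
    funext (beta_apply hβ)]
  exact continuous_toTorus.comp hβ.continuous

variable [CompactSpace M]

theorem isEquivariant_betaLift_and_tendsto (hp : IsQuotientMap p)
    (hF : IsEquivariant Γ p (abelJacobi p η x₀)) (hft : ∀ x, p (ft x) = f (p x))
    (hA : IsExpanding (homologyMatrix Γ f)) :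
    IsEquivariant Γ p (betaLift (homologyMatrix Γ f) p η x₀ ft) ∧
      ∀ x, Tendsto (fun k => (mulVecCLM (realMatrix (homologyMatrix Γ f))⁻¹ ^ k)
        (abelJacobi p η x₀ (ft^[k] x))) atTop
        (𝓝 (betaLift (homologyMatrix Γ f) p η x₀ ft x)) := by
  obtain ⟨β, hβ, hlim⟩ := hF.exists_tendsto hp hft hA
  have heq : betaLift (homologyMatrix Γ f) p η x₀ ft = β := funext fun x => by
    simp only [betaLift, inv_pow_mulVec_eq_pow_mulVecCLM_inv]
    exact (hlim x).limUnder_eq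
  exact heq ▸ ⟨hβ, hlim⟩

theorem betaLift_map (hp : IsQuotientMap p) (hF : IsEquivariant Γ p (abelJacobi p η x₀))
    (hft : ∀ x, p (ft x) = f (p x)) (hA : IsExpanding (homologyMatrix Γ f)) (x : Mt) :
    betaLift (homologyMatrix Γ f) p η x₀ ft (ft x) =
      (realMatrix (homologyMatrix Γ f)).mulVec (betaLift (homologyMatrix Γ f) p η x₀ ft x) := by
  have hlim := (isEquivariant_betaLift_and_tendsto hp hF hft hA).2
  have hdet := (Matrix.isUnit_iff_isUnit_det _).1 hA.isUnit_realMatrix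
  rw [← apply_eq_of_tendsto_pow_apply_iterate hlim x, mulVecCLM_apply, Matrix.mulVec_mulVec,
    Matrix.mul_nonsing_inv _ hdet, Matrix.one_mulVec]

theorem beta_map (hp : IsQuotientMap p) (hF : IsEquivariant Γ p (abelJacobi p η x₀))
    (hft : ∀ x, p (ft x) = f (p x)) (hA : IsExpanding (homologyMatrix Γ f)) (x : M) :
    beta (homologyMatrix Γ f) p η x₀ ft (f x) =
      toralEndo (homologyMatrix Γ f) (beta (homologyMatrix Γ f) p η x₀ ft x) := by
  have hβ := (isEquivariant_betaLift_and_tendsto hp hF hft hA).1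
  obtain ⟨y, rfl⟩ := hp.surjective x
  rw [← hft, beta_apply hβ, beta_apply hβ, betaLift_map hp hF hft hA, toTorus_mulVec]

theorem betaLift_eq_betaLift (hp : IsQuotientMap p) (hF : IsEquivariant Γ p (abelJacobi p η x₀))
    (hF' : IsEquivariant Γ p (abelJacobi p η' x₀')) (hft : ∀ x, p (ft x) = f (p x))
    (hA : IsExpanding (homologyMatrix Γ f)) :
    betaLift (homologyMatrix Γ f) p η x₀ ft = betaLift (homologyMatrix Γ f) p η' x₀' ft :=
  hF.eq_of_tendsto hp hF' hA (isEquivariant_betaLift_and_tendsto hp hF hft hA).2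
    (isEquivariant_betaLift_and_tendsto hp hF' hft hA).2

end Beta

end AbelianCover

end

open AbelianCover in
/-- The covering `p` may be larger than the universal Abelian cover, for instance the universal
cover; `deck Γ p v x` is then one of several translates of `x`. -/
theorem mainTheorem5_general {n b : ℕ}
    {M : Type*} [TopologicalSpace M] [ChartedSpace (EuclideanSpace ℝ (Fin n)) M]
    [IsManifold (𝓡 n) ∞ M] [CompactSpace M] [ConnectedSpace M]
    (Γ : Module.Basis (Fin b) ℤ (H1 M))
    {Mt : Type*} [TopologicalSpace Mt] [PathConnectedSpace Mt] (p : C(Mt, M))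
    (hp : IsCoveringMap p)
    (hrange : ∀ x, (FundamentalGroup.map p x).range ≤ commutator (FundamentalGroup M (p x)))
    (f : C(M, M)) (ft : C(Mt, Mt)) (hft : ∀ x, p (ft x) = f (p x))
    (A : Matrix (Fin b) (Fin b) ℤ) (hA : A = homologyMatrix Γ f) (hexp : IsExpanding A) :
    (∀ k : ℕ, IsUnit (realMatrix A ^ k)) ∧
    (∀ k : ℕ, 1 ≤ k → IsUnit (realMatrix A ^ k - 1)) ∧
    (∀ (η : Fin b → ClosedOneForm n M) (x₀ : Mt), IsDualTo η Γ →
      (∀ x : Mt, Tendsto (fun k : ℕ => ((realMatrix A) ^ k)⁻¹.mulVec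
        (abelJacobi p η x₀ (ft^[k] x))) atTop (𝓝 (betaLift A p η x₀ ft x))) ∧
      (∀ M₀ : Set Mt, IsFundamentalDomain Γ p M₀ → ∀ x : Mt, Tendsto
        (fun k : ℕ => ((realMatrix A) ^ k - 1)⁻¹.mulVec
          (fun i => (displacement Γ p M₀ ft k x i : ℝ)))
        atTop (𝓝 (betaLift A p η x₀ ft x))) ∧
      (∀ x : Mt, beta A p η x₀ ft (p x) = toTorus (betaLift A p η x₀ ft x)) ∧
      Continuous (beta A p η x₀ ft) ∧
      (∀ x : M, beta A p η x₀ ft (f x) = toralEndo A (beta A p η x₀ ft x))) ∧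
    (∀ (η η' : Fin b → ClosedOneForm n M) (x₀ x₀' : Mt), IsDualTo η Γ → IsDualTo η' Γ →
      betaLift A p η x₀ ft = betaLift A p η' x₀' ft ∧
      beta A p η x₀ ft = beta A p η' x₀' ft) := by
  subst hA
  have := ChartedSpace.locallyPathConnectedSpace (EuclideanSpace ℝ (Fin n)) M
  have : PathConnectedSpace M := pathConnectedSpace_iff_connectedSpace.2 inferInstance
  have hq : IsQuotientMap p := hp.isQuotientMap (surjective_of_isCoveringMap hp)
  have hF {η : Fin b → ClosedOneForm n M} (x₀ : Mt) (hη : IsDualTo η Γ) :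
      IsEquivariant Γ p (abelJacobi p η x₀) :=
    isEquivariant_abelJacobi hp.isLocalHomeomorph (hrange x₀) hη
  refine ⟨fun k => hexp.isUnit_realMatrix.pow k, fun k => hexp.isUnit_pow_sub_one,
    fun η x₀ hη => ?_, fun η η' x₀ x₀' hη hη' => ?_⟩
  · obtain ⟨hβ, hlim⟩ := isEquivariant_betaLift_and_tendsto hq (hF x₀ hη) hft hexp
    refine ⟨fun x => ?_, fun M₀ hM x => ?_, beta_apply hβ, continuous_beta hβ hq,
      beta_map hq (hF x₀ hη) hft hexp⟩
    · simpa only [inv_pow_mulVec_eq_pow_mulVecCLM_inv] using hlim x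
    · exact hexp.tendsto_inv_pow_sub_one_mulVec
        ((hF x₀ hη).tendsto_pow_mulVecCLM_inv_displacement hp hexp (hlim x) hM)
  · have heq := betaLift_eq_betaLift hq (hF x₀ hη) (hF x₀' hη') hft hexp
    exact ⟨heq, funext fun x => by simp only [beta, heq]⟩

theorem mainTheorem5 {n b : ℕ}
    {M : Type*} [TopologicalSpace M] [ChartedSpace (EuclideanSpace ℝ (Fin n)) M]
    [IsManifold (𝓡 n) ∞ M] [T2Space M] [CompactSpace M] [ConnectedSpace M]
    (Γ : Module.Basis (Fin b) ℤ (AbelianCover.H1 M))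
    {Mt : Type*} [TopologicalSpace Mt] (p : C(Mt, M))
    (hp : AbelianCover.IsUniversalAbelianCover p)
    (f : C(M, M)) (ft : C(Mt, Mt)) (hft : ∀ x, p (ft x) = f (p x))
    (A : Matrix (Fin b) (Fin b) ℤ) (hA : A = AbelianCover.homologyMatrix Γ f)
    (hexp : AbelianCover.IsExpanding A) :
    -- the matrices inverted below are invertible
    (∀ k : ℕ, IsUnit (AbelianCover.realMatrix A ^ k)) ∧
    (∀ k : ℕ, 1 ≤ k → IsUnit (AbelianCover.realMatrix A ^ k - 1)) ∧
    (∀ (η : Fin b → AbelianCover.ClosedOneForm n M) (x₀ : Mt), AbelianCover.IsDualTo η Γ →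
      -- the limit defining `β̃` exists
      (∀ x : Mt, Tendsto
        (fun k : ℕ => ((AbelianCover.realMatrix A) ^ k)⁻¹.mulVec
          (AbelianCover.abelJacobi p η x₀ (ft^[k] x)))
        atTop (𝓝 (AbelianCover.betaLift A p η x₀ ft x))) ∧
      -- the normalized approximate displacements converge to `β̃`
      (∀ M₀ : Set Mt, AbelianCover.IsFundamentalDomain Γ p M₀ → ∀ x : Mt, Tendsto
        (fun k : ℕ => ((AbelianCover.realMatrix A) ^ k - 1)⁻¹.mulVec
          (fun i => (AbelianCover.displacement Γ p M₀ ft k x i : ℝ)))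
        atTop (𝓝 (AbelianCover.betaLift A p η x₀ ft x))) ∧
      -- `β̃` descends to a continuous semiconjugacy `β` from `f` to `Φ_A`
      (∀ x : Mt, AbelianCover.beta A p η x₀ ft (p x) =
        AbelianCover.toTorus (AbelianCover.betaLift A p η x₀ ft x)) ∧
      Continuous (AbelianCover.beta A p η x₀ ft) ∧
      (∀ x : M, AbelianCover.beta A p η x₀ ft (f x) =
        AbelianCover.toralEndo A (AbelianCover.beta A p η x₀ ft x))) ∧
    -- neither map depends on the one-forms (or the base point) used to define `ι̃`
    (∀ (η η' : Fin b → AbelianCover.ClosedOneForm n M) (x₀ x₀' : Mt),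
      AbelianCover.IsDualTo η Γ → AbelianCover.IsDualTo η' Γ →
      AbelianCover.betaLift A p η x₀ ft = AbelianCover.betaLift A p η' x₀' ft ∧
      AbelianCover.beta A p η x₀ ft = AbelianCover.beta A p η' x₀' ft) := by
  have := hp.pathConnected
  exact mainTheorem5_general Γ p hp.isCoveringMap (fun x => (hp.range_eq x).le) f ft hft A hA hexp
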